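/- Let $\mathbb{X}$ and $\mathbb{Y}$ be locally compact Polish spaces equipped with locally finite positive Borel measures $\lambda$ and $\nu$. Let $U:\mathbb{X}\to\mathbb{R}$ and $V:\mathbb{Y}\to\mathbb{R}$ be locally bounded functions with compact sub-level sets, and let $W:\mathbb{X}\times\mathbb{Y}\to\mathbb{R}$ be a measurable, locally bounded function with $\sup e^{-W}<\infty$. For a function $F$ write $\lambda_F(dx)=e^{-F(x)}\lambda(dx)$ and $\nu_F(dy)=e^{-F(y)}\nu(dy)$. Assume that $\mu:=\lambda_U$ and $\eta:=\nu_V$ are probability measures and that $K(x,dy)=e^{-W(x,y)}\nu(dy)$ is a Markov transition from $\mathbb{X}$ to $\mathbb{Y}$. **Sinkhorn transitions.** Set $\mathcal{K}_0=K$. For $n\ge 0$, define the densities $k_{2n}(x,\cdot)=d\mathcal{K}_{2n}(x,\cdot)/d\nu$ and $k_{2n+1}(y,\cdot)=d\mathcal{K}_{2n+1}(y,\cdot)/d\lambda$ successively, at every point, from $k_0(x,y)=e^{-W(x,y)}$ by Bayes' rule $$k_{2n+1}(y,x)=\frac{e^{-U(x)}k_{2n}(x,y)}{\int e^{-U(x')}k_{2n}(x',y)\,\lambda(dx')},\qquad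 k_{2n+2}(x,y)=\frac{e^{-V(y)}k_{2n+1}(y,x)}{\int e^{-V(y')}k_{2n+1}(y',x)\,\nu(dy')}.$$ Put $\pi_{2n}=\mu\mathcal{K}_{2n}$, $\pi_{2n+1}=\eta\mathcal{K}_{2n+1}$, $\mathcal{S}_{2n+1}=\mathcal{K}_{2n}\mathcal{K}_{2n+1}$ (first $\mathcal{K}_{2n}$, then $\mathcal{K}_{2n+1}$) and $\mathcal{S}_{2(n+1)}=\mathcal{K}_{2n+1}\mathcal{K}_{2(n+1)}$. **Condition $(\mathtt{A})$.** Let $\mathcal{B}_0$ be the set of functions $\theta>0$ such that $1/\theta$ is locally bounded above, bounded below by a positive constant, and has compact sub-level sets. Assume that $\delta\in\,]0,1/2[$ is such that $\lambda_{(1-2\delta)U}$ and $\nu_{(1-2\delta)V}$ have finite total mass, that the integrals $W^V(x)=\int W(x,y)\,\nu_V(dy)$ and $W_U(y)=\int W(x,y)\,\lambda_U(dx)$ are finite for all $x$ and $y$, and that there are $\theta_u\in\mathcal{B}_0(\mathbb{X})$ and $\theta_v\in\mathcal{B}_0(\mathbb{Y})$ with $$e^{-(\delta U-W^V)}\le\theta_u\qquad\text{and}\qquad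 e^{-(\delta V-W_U)}\le\theta_v .$$ **Weighted norms.** For a positive function $g$ let $|\!|\!|\mu_1-\mu_2|\!|\!|_g=|\mu_1-\mu_2|(g)$, where $|\mu_1-\mu_2|$ is the total variation measure, and let $$\mathsf{lip}_{g,h}(L)=\sup\frac{|\!|\!|\mu_1L-\mu_2L|\!|\!|_h}{|\!|\!|\mu_1-\mu_2|\!|\!|_g}$$ over all probability measures $\mu_1,\mu_2$ with $\mu_1(g),\mu_2(g)<\infty$ and $|\!|\!|\mu_1-\mu_2|\!|\!|_g>0$. For $a>0$ put $g_a=\tfrac12+a\,e^{\delta U}$ and $h_a=\tfrac12+a\,e^{\delta V}$. **Claim.** All $\mathcal{K}_n$, $n\ge 0$, are Markov transitions, and there exist $a>0$ and $\varrho\in\,]0,1[$ such that $$\mathsf{lip}_{g_a,h_a}(\mathcal{K}_{2n})\vee\mathsf{lip}_{h_a,g_a}(\mathcal{K}_{2n+1})\le\varrho\qquad\text{for all }n\ge 1.\tag{1}$$ Moreover, for all $a>0$ and $\varrho\in\,]0,1[$ satisfying (1) we have $$\sup_{n\ge 1}\Big(\mathsf{lip}_{g_a,g_a}(\mathcal{S}_{2n+1})\vee\mathsf{lip}_{h_a,h_a}(\mathcal{S}_{2(n+1)})\Big)\le\varrho^2,$$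 and, for every $n\ge 1$, $$|\!|\!|\pi_{2(n+1)}-\eta|\!|\!|_{h_a}\le\varrho^2\,|\!|\!|\pi_{2n}-\eta|\!|\!|_{h_a}\qquad\text{and}\qquad|\!|\!|\pi_{2n+1}-\mu|\!|\!|_{g_a}\le\varrho^2\,|\!|\!|\pi_{2n-1}-\mu|\!|\!|_{g_a}.$$ -/

import Mathlib

open MeasureTheory ProbabilityTheory Filter Topology
open scoped ENNReal

noncomputable section

namespace Sinkhorn

/-- The function `f` is bounded on a neighbourhood of every point. -/
def LocallyBounded {Z : Type*} [TopologicalSpace Z] (f : Z → ℝ) : Prop :=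
  ∀ z, ∃ C : ℝ, ∀ᶠ w in 𝓝 z, |f w| ≤ C

/-- All sub-level sets `{f ≤ l}`, `l` real, are compact. -/
def CompactSublevels {Z : Type*} [TopologicalSpace Z] (f : Z → ℝ) : Prop :=
  ∀ l : ℝ, IsCompact {z | f z ≤ l}

/-- The class `B_∞` of locally upper bounded, uniformly positive functions with compact
sub-level sets. -/
structure IsBInfty {Z : Type*} [TopologicalSpace Z] (f : Z → ℝ) : Prop where
  locally_upper_bounded : ∀ z, ∃ C : ℝ, ∀ᶠ w in 𝓝 z, f w ≤ C
  uniformly_positive : ∃ c : ℝ, 0 < c ∧ ∀ z, c ≤ f z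
  compact_sublevels : CompactSublevels f

/-- The class `B_0` of the functions `θ` such that `1 / θ` belongs to `B_∞`
(such a `θ` is automatically positive). -/
def IsBZero {Z : Type*} [TopologicalSpace Z] (θ : Z → ℝ) : Prop :=
  IsBInfty fun z => 1 / θ z

/-- The Gibbs measure `ρ_F(dz) = e^{-F(z)} ρ(dz)`. -/
def gibbs {Z : Type*} [MeasurableSpace Z] (ρ : Measure Z) (F : Z → ℝ) : Measure Z :=
  ρ.withDensity fun z => ENNReal.ofReal (Real.exp (-F z))

/-- Condition (A) for the parameter `δ`. The integrals `W^V(x) = ∫ W(x,y) ν_V(dy)` and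
`W_U(y) = ∫ W(x,y) λ_U(dx)` are required to be finite, since `e^{-(δU - W^V)} ≤ θ_u < ∞` and
`e^{-(δV - W_U)} ≤ θ_v < ∞` only make sense or hold in this case. -/
structure ConditionA {X Y : Type*} [TopologicalSpace X] [TopologicalSpace Y]
    [MeasurableSpace X] [MeasurableSpace Y] (lam : Measure X) (nu : Measure Y)
    (U : X → ℝ) (V : Y → ℝ) (W : X → Y → ℝ) (δ : ℝ) : Prop where
  delta_pos : 0 < δ
  delta_lt : δ < 1 / 2
  finite_left : gibbs lam (fun x => (1 - 2 * δ) * U x) Set.univ < ∞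
  finite_right : gibbs nu (fun y => (1 - 2 * δ) * V y) Set.univ < ∞
  integrable_left : ∀ x, Integrable (fun y => W x y) (gibbs nu V)
  integrable_right : ∀ y, Integrable (fun x => W x y) (gibbs lam U)
  exists_theta_left : ∃ θ : X → ℝ, IsBZero θ ∧
    ∀ x, Real.exp (-(δ * U x - ∫ y, W x y ∂(gibbs nu V))) ≤ θ x
  exists_theta_right : ∃ θ : Y → ℝ, IsBZero θ ∧
    ∀ y, Real.exp (-(δ * V y - ∫ x, W x y ∂(gibbs lam U))) ≤ θ y

/-- Bayes' rule for densities. If `p` is the density with respect to `ρ` of a random variable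
`A`, and `q a` is the conditional density of `B` given `A = a`, then `bayes ρ p q b` is the
conditional density with respect to `ρ` of `A` given `B = b`. -/
def bayes {A B : Type*} [MeasurableSpace A] (ρ : Measure A) (p : A → ℝ≥0∞)
    (q : A → B → ℝ≥0∞) : B → A → ℝ≥0∞ :=
  fun b a => p a * q a b / ∫⁻ a', p a' * q a' b ∂ρ

section Transitions

variable {X Y : Type*} [MeasurableSpace X] [MeasurableSpace Y]
  (lam : Measure X) (nu : Measure Y) (U : X → ℝ) (V : Y → ℝ) (W : X → Y → ℝ)

/-- The density `y ↦ k_{2n}(x,y)` of the Sinkhorn transition `K_{2n}(x,dy)` with respect to `ν`.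
It starts from `e^{-W(x,y)}`. Then `K_{2n+1}` is the conditional law of the first coordinate given
the second one under `λ_U × K_{2n}`, and `K_{2n+2}` is the conditional law of the second
coordinate given the first one under `ν_V(dy) K_{2n+1}(y,dx)`. -/
def evenDensity : ℕ → X → Y → ℝ≥0∞
  | 0 => fun x y => ENNReal.ofReal (Real.exp (-W x y))
  | n + 1 => bayes nu (fun y => ENNReal.ofReal (Real.exp (-V y)))
      (bayes lam (fun x => ENNReal.ofReal (Real.exp (-U x))) (evenDensity n))

/-- The density `x ↦ k_{2n+1}(y,x)` of `K_{2n+1}(y,dx)` with respect to `λ`. -/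
def oddDensity (n : ℕ) : Y → X → ℝ≥0∞ :=
  bayes lam (fun x => ENNReal.ofReal (Real.exp (-U x))) (evenDensity lam nu U V W n)

/-- The Sinkhorn transition `K_{2n}` from `X` into `Y`. -/
def evenK [SFinite nu] (n : ℕ) : Kernel X Y :=
  Kernel.withDensity (Kernel.const X nu) (evenDensity lam nu U V W n)

/-- The Sinkhorn transition `K_{2n+1}` from `Y` into `X`. -/
def oddK [SFinite lam] (n : ℕ) : Kernel Y X :=
  Kernel.withDensity (Kernel.const Y lam) (oddDensity lam nu U V W n)

/-- The Sinkhorn marginal `π_{2n} = μ K_{2n}` with `μ = λ_U`. -/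
def evenMarginal [SFinite nu] (n : ℕ) : Measure Y :=
  (gibbs lam U).bind (evenK lam nu U V W n)

/-- The Sinkhorn marginal `π_{2n+1} = η K_{2n+1}` with `η = ν_V`. -/
def oddMarginal [SFinite lam] (n : ℕ) : Measure X :=
  (gibbs nu V).bind (oddK lam nu U V W n)

/-- The Gibbs-type transition `S_{2n+1} = K_{2n} K_{2n+1}` from `X` into itself
(first `K_{2n}`, then `K_{2n+1}`). -/
def oddS [SFinite lam] [SFinite nu] (n : ℕ) : Kernel X X :=
  Kernel.comp (oddK lam nu U V W n) (evenK lam nu U V W n)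

/-- The Gibbs-type transition `S_{2(n+1)} = K_{2n+1} K_{2(n+1)}` from `Y` into itself
(first `K_{2n+1}`, then `K_{2(n+1)}`). -/
def evenS [SFinite lam] [SFinite nu] (n : ℕ) : Kernel Y Y :=
  Kernel.comp (evenK lam nu U V W (n + 1)) (oddK lam nu U V W n)

end Transitions

/-- The `g`-weighted total variation norm `|m₁ - m₂|(g)`. For finite measures the truncated
differences `m₁ - m₂` and `m₂ - m₁` of measures are the positive and negative parts of the
Hahn-Jordan decomposition, see `weightedTV_eq_totalVariation`. -/
def weightedTV {Z : Type*} [MeasurableSpace Z] (g : Z → ℝ) (m₁ m₂ : Measure Z) : ℝ≥0∞ :=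
  ∫⁻ z, ENNReal.ofReal (g z) ∂((m₁ - m₂) + (m₂ - m₁))

theorem weightedTV_eq_totalVariation {Z : Type*} [MeasurableSpace Z] (g : Z → ℝ)
    (m₁ m₂ : Measure Z) [IsFiniteMeasure m₁] [IsFiniteMeasure m₂] :
    weightedTV g m₁ m₂ = ∫⁻ z, ENNReal.ofReal (g z)
      ∂(m₁.toSignedMeasure - m₂.toSignedMeasure).totalVariation := by
  rw [SignedMeasure.totalVariation, Measure.toJordanDecomposition_toSignedMeasure_sub]
  rfl

/-- The set `Prob_g(Z)` of the probability measures `m` with `m(g) < ∞`. -/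
def probG {Z : Type*} [MeasurableSpace Z] (g : Z → ℝ) : Set (Measure Z) :=
  {m | IsProbabilityMeasure m ∧ ∫⁻ z, ENNReal.ofReal (g z) ∂m < ∞}

/-- The weighted Lipschitz constant `lip_{g,h}(K)`: the supremum of
`|m₁K - m₂K|(h) / |m₁ - m₂|(g)` over all `m₁, m₂` in `Prob_g` with `|m₁ - m₂|(g) > 0`. -/
def lip {Z Z' : Type*} [MeasurableSpace Z] [MeasurableSpace Z'] (g : Z → ℝ) (h : Z' → ℝ)
    (K : Kernel Z Z') : ℝ≥0∞ :=
  ⨆ (m₁ : Measure Z) (m₂ : Measure Z) (_ : m₁ ∈ probG g) (_ : m₂ ∈ probG g)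
    (_ : 0 < weightedTV g m₁ m₂),
    weightedTV h (m₁.bind K) (m₂.bind K) / weightedTV g m₁ m₂

/-- The weight `1/2 + a e^{δF}`. -/
def weight {Z : Type*} (a δ : ℝ) (F : Z → ℝ) : Z → ℝ :=
  fun z => 1 / 2 + a * Real.exp (δ * F z)

/-- The contraction estimates
`lip_{g_a,h_a}(K_{2n}) ∨ lip_{h_a,g_a}(K_{2n+1}) ≤ r` for all `n ≥ 1`,
with the weights `g_a = 1/2 + a e^{δU}` and `h_a = 1/2 + a e^{δV}`. -/
def LipSinkhorn {X Y : Type*} [MeasurableSpace X] [MeasurableSpace Y]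
    (lam : Measure X) (nu : Measure Y) [SFinite lam] [SFinite nu]
    (U : X → ℝ) (V : Y → ℝ) (W : X → Y → ℝ) (δ a r : ℝ) : Prop :=
  ∀ n : ℕ, 1 ≤ n →
    lip (weight a δ U) (weight a δ V) (evenK lam nu U V W n) ⊔
      lip (weight a δ V) (weight a δ U) (oddK lam nu U V W n) ≤ ENNReal.ofReal r

end Sinkhorn

end

/-! The densities of the Sinkhorn transitions are diagonal scalings `u(x) e^{-W(x,y)} v(y)` whose
factors follow the Schrödinger iteration. By Gibbs' inequality `∫ log u_n dμ` and `∫ log v_n dη`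
never decrease along this iteration, so Jensen's inequality yields bounds `b ≤ u_n ≤ M e^{W^V}` and
`b ≤ v_n ≤ M e^{W_U}` that are uniform in `n`. Condition (A) turns them into a drift condition of
arbitrarily small slope for the Lyapunov functions `e^{δU}` and `e^{δV}`, and into a minorization
on their sub-level sets, both uniform in `n`. The weighted Dobrushin argument of Hairer and
Mattingly then gives the contraction. Finally, Bayes' rule is a time reversal, so two consecutive
Sinkhorn transitions leave `μ` or `η` invariant, and the marginals approach these measures at the
squared rate. -/

namespace Sinkhorn

section WeightedTV

variable {Z : Type*} [MeasurableSpace Z] {g ψ : Z → ℝ} {m₁ m₂ : Measure Z}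

theorem add_measure_sub_comm (m₁ m₂ : Measure Z) [IsFiniteMeasure m₁] [IsFiniteMeasure m₂] :
    m₁ + (m₂ - m₁) = m₂ + (m₁ - m₂) := by
  have h := Measure.sub_toSignedMeasure_eq_toSignedMeasure_sub (μ := m₁) (ν := m₂)
  rw [sub_eq_sub_iff_add_eq_add, ← Measure.toSignedMeasure_add, ← Measure.toSignedMeasure_add,
    Measure.toSignedMeasure_eq_toSignedMeasure_iff] at h
  rw [h, add_comm]

theorem weightedTV_le (g : Z → ℝ) (m₁ m₂ : Measure Z) :
    weightedTV g m₁ m₂ ≤ ∫⁻ z, ENNReal.ofReal (g z) ∂m₁ + ∫⁻ z, ENNReal.ofReal (g z) ∂m₂ := by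
  rw [weightedTV, lintegral_add_measure]
  exact add_le_add (lintegral_mono' Measure.sub_le le_rfl) (lintegral_mono' Measure.sub_le le_rfl)

theorem weightedTV_ne_top (h₁ : m₁ ∈ probG g) (h₂ : m₂ ∈ probG g) : weightedTV g m₁ m₂ ≠ ∞ :=
  ((weightedTV_le g m₁ m₂).trans_lt (ENNReal.add_lt_top.2 ⟨h₁.2, h₂.2⟩)).ne

theorem weightedTV_self (g : Z → ℝ) (m : Measure Z) [IsFiniteMeasure m] :
    weightedTV g m m = 0 := by
  simp [weightedTV]

theorem weightedTV_const_mul {r : ℝ} (hr : 0 ≤ r) (g : Z → ℝ) (m₁ m₂ : Measure Z) :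
    weightedTV (fun z => r * g z) m₁ m₂ = ENNReal.ofReal r * weightedTV g m₁ m₂ := by
  simp_rw [weightedTV, ENNReal.ofReal_mul hr]
  exact lintegral_const_mul' _ _ ENNReal.ofReal_ne_top

theorem eq_of_weightedTV_eq_zero [IsFiniteMeasure m₁] [IsFiniteMeasure m₂] (hg : Measurable g)
    (g0 : ∀ z, 0 < g z) (h : weightedTV g m₁ m₂ = 0) : m₁ = m₂ := by
  have hsum : (m₁ - m₂) + (m₂ - m₁) = 0 := by
    rw [weightedTV, lintegral_eq_zero_iff hg.ennreal_ofReal] at h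
    rw [← ae_eq_bot, ← Filter.eventually_false_iff_eq_bot]
    filter_upwards [h] with z hz
    exact (ENNReal.ofReal_eq_zero.1 hz).not_gt (g0 z)
  have h₁ : m₁ - m₂ = 0 := le_antisymm (hsum ▸ Measure.le_add_right le_rfl) (Measure.zero_le _)
  have h₂ : m₂ - m₁ = 0 := le_antisymm (hsum ▸ Measure.le_add_left le_rfl) (Measure.zero_le _)
  simpa [h₁, h₂] using add_measure_sub_comm m₁ m₂

theorem weightedTV_add_two_mul_lintegral_le [IsFiniteMeasure m₁] [IsFiniteMeasure m₂]
    (g : Z → ℝ) {m : Measure Z} (h₁ : m ≤ m₁) (h₂ : m ≤ m₂) :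
    weightedTV g m₁ m₂ + 2 * ∫⁻ z, ENNReal.ofReal (g z) ∂m ≤
      ∫⁻ z, ENNReal.ofReal (g z) ∂m₁ + ∫⁻ z, ENNReal.ofReal (g z) ∂m₂ := by
  have := isFiniteMeasure_of_le m₁ h₁
  have sub_add_le {p q : Measure Z} (hp : m ≤ p) (hq : m ≤ q) : p - q + m ≤ p := by
    calc p - q + m ≤ p - m + m := by
          gcongr
          refine Measure.sub_le_of_le_add (Measure.sub_add_cancel_of_le hp |>.ge.trans ?_)
          gcongr
      _ = p := Measure.sub_add_cancel_of_le hp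
  calc weightedTV g m₁ m₂ + 2 * ∫⁻ z, ENNReal.ofReal (g z) ∂m
      = ∫⁻ z, ENNReal.ofReal (g z) ∂(m₁ - m₂ + m)
          + ∫⁻ z, ENNReal.ofReal (g z) ∂(m₂ - m₁ + m) := by
        simp only [weightedTV, lintegral_add_measure]
        ring
    _ ≤ _ := add_le_add (lintegral_mono' (sub_add_le h₁ h₂) le_rfl)
        (lintegral_mono' (sub_add_le h₂ h₁) le_rfl)

theorem integrable_of_mem_probG {m : Measure Z} (hg : Measurable g) (g0 : ∀ z, 0 ≤ g z)
    (h : m ∈ probG g) : Integrable g m :=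
  (lintegral_ofReal_ne_top_iff_integrable hg.aestronglyMeasurable (.of_forall g0)).1 h.2.ne

theorem dirac_mem_probG (hg : Measurable g) (z : Z) : Measure.dirac z ∈ probG g :=
  ⟨inferInstance, by simp [lintegral_dirac' z hg.ennreal_ofReal]⟩

theorem toReal_weightedTV (g0 : ∀ z, 0 ≤ g z) (h₁ : Integrable g m₁) (h₂ : Integrable g m₂) :
    (weightedTV g m₁ m₂).toReal = ∫ z, g z ∂(m₁ - m₂) + ∫ z, g z ∂(m₂ - m₁) := by
  have i₁ : Integrable g (m₁ - m₂) := h₁.mono_measure Measure.sub_le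
  have i₂ : Integrable g (m₂ - m₁) := h₂.mono_measure Measure.sub_le
  rw [weightedTV, ← integral_add_measure i₁ i₂, integral_eq_lintegral_of_nonneg_ae
    (.of_forall g0) (i₁.add_measure i₂).aestronglyMeasurable]

theorem integral_sub_integral_eq [IsFiniteMeasure m₁] [IsFiniteMeasure m₂]
    (h₁ : Integrable ψ m₁) (h₂ : Integrable ψ m₂) :
    ∫ z, ψ z ∂m₁ - ∫ z, ψ z ∂m₂ = ∫ z, ψ z ∂(m₁ - m₂) - ∫ z, ψ z ∂(m₂ - m₁) := by
  have key : ∫ z, ψ z ∂m₁ + ∫ z, ψ z ∂(m₂ - m₁) = ∫ z, ψ z ∂m₂ + ∫ z, ψ z ∂(m₁ - m₂) := by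
    rw [← integral_add_measure h₁ (h₂.mono_measure Measure.sub_le),
      ← integral_add_measure h₂ (h₁.mono_measure Measure.sub_le), add_measure_sub_comm]
  linarith

theorem integral_sub_integral_le_toReal_weightedTV [IsFiniteMeasure m₁] [IsFiniteMeasure m₂]
    (hψ : Measurable ψ) (hψg : ∀ z, |ψ z| ≤ g z) (h₁ : Integrable g m₁) (h₂ : Integrable g m₂) :
    ∫ z, ψ z ∂m₁ - ∫ z, ψ z ∂m₂ ≤ (weightedTV g m₁ m₂).toReal := by
  have hψi {m : Measure Z} (hm : Integrable g m) : Integrable ψ m :=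
    hm.mono' hψ.aestronglyMeasurable (.of_forall hψg)
  have i₁ : Integrable g (m₁ - m₂) := h₁.mono_measure Measure.sub_le
  have i₂ : Integrable g (m₂ - m₁) := h₂.mono_measure Measure.sub_le
  rw [integral_sub_integral_eq (hψi h₁) (hψi h₂),
    toReal_weightedTV (fun z => (abs_nonneg _).trans (hψg z)) h₁ h₂, sub_eq_add_neg, ← integral_neg]
  exact add_le_add (integral_mono (hψi i₁) i₁ fun z => (le_abs_self _).trans (hψg z))
    (integral_mono (hψi i₂).neg i₂ fun z => (neg_le_abs _).trans (hψg z))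

theorem exists_integral_sub_integral_eq_toReal_weightedTV [IsFiniteMeasure m₁]
    [IsFiniteMeasure m₂] (hg : Measurable g) (g0 : ∀ z, 0 ≤ g z) (h₁ : Integrable g m₁)
    (h₂ : Integrable g m₂) :
    ∃ f : Z → ℝ, Measurable f ∧ (∀ z, |f z| ≤ g z) ∧
      ∫ z, f z ∂m₁ - ∫ z, f z ∂m₂ = (weightedTV g m₁ m₂).toReal := by
  classical
  obtain ⟨s, hs, hs₁, hs₂⟩ := Measure.mutually_singular_measure_sub (μ := m₁) (ν := m₂)
  let f : Z → ℝ := s.piecewise (fun z => -g z) g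
  have hf : Measurable f := .piecewise hs hg.neg hg
  have hfg (z : Z) : |f z| ≤ g z := by
    by_cases hz : z ∈ s <;> simp [f, hz, abs_of_nonneg (g0 z)]
  have hfi {m : Measure Z} (hm : Integrable g m) : Integrable f m :=
    hm.mono' hf.aestronglyMeasurable (.of_forall hfg)
  have f_eq : f =ᵐ[m₁ - m₂] g := by
    filter_upwards [measure_eq_zero_iff_ae_notMem.1 hs₁] with z hz
    simp [f, hz]
  have f_eq_neg : f =ᵐ[m₂ - m₁] fun z => -g z := by
    filter_upwards [measure_eq_zero_iff_ae_notMem.1 hs₂] with z hz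
    simp [f, Set.notMem_compl_iff.1 hz]
  refine ⟨f, hf, hfg, ?_⟩
  rw [integral_sub_integral_eq (hfi h₁) (hfi h₂), toReal_weightedTV g0 h₁ h₂,
    integral_congr_ae f_eq, integral_congr_ae f_eq_neg, integral_neg, sub_neg_eq_add]

end WeightedTV

section Lip

variable {Z Z' Z'' : Type*} [MeasurableSpace Z] [MeasurableSpace Z'] [MeasurableSpace Z'']
  {g : Z → ℝ} {h : Z' → ℝ} {k : Z'' → ℝ} {K : Kernel Z Z'} {L : Kernel Z' Z''} {r : ℝ}

theorem weightedTV_bind_le_lip_mul (hg : Measurable g) (g0 : ∀ z, 0 < g z) (h : Z' → ℝ)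
    (K : Kernel Z Z') [IsFiniteKernel K] {m₁ m₂ : Measure Z} (h₁ : m₁ ∈ probG g)
    (h₂ : m₂ ∈ probG g) :
    weightedTV h (m₁.bind K) (m₂.bind K) ≤ lip g h K * weightedTV g m₁ m₂ := by
  have := h₁.1
  have := h₂.1
  rcases eq_or_ne (weightedTV g m₁ m₂) 0 with h' | h'
  · rw [eq_of_weightedTV_eq_zero hg g0 h', weightedTV_self]
    exact zero_le
  · rw [← ENNReal.div_le_iff h' (weightedTV_ne_top h₁ h₂)]
    exact le_iSup_of_le m₁ <| le_iSup_of_le m₂ <| le_iSup_of_le h₁ <| le_iSup_of_le h₂ <|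
      le_iSup_of_le (pos_iff_ne_zero.2 h') le_rfl

theorem lip_le {c : ℝ≥0∞} (H : ∀ m₁ ∈ probG g, ∀ m₂ ∈ probG g,
    weightedTV h (m₁.bind K) (m₂.bind K) ≤ c * weightedTV g m₁ m₂) : lip g h K ≤ c :=
  iSup_le fun m₁ => iSup_le fun m₂ => iSup_le fun h₁ => iSup_le fun h₂ => iSup_le fun _ =>
    ENNReal.div_le_of_le_mul (H m₁ h₁ m₂ h₂)

theorem lip_comp_le [IsFiniteKernel K] [IsFiniteKernel L] (hg : Measurable g)
    (g0 : ∀ z, 0 < g z) (hh : Measurable h) (h0 : ∀ z, 0 < h z)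
    (hK : Set.MapsTo (fun m : Measure Z => m.bind K) (probG g) (probG h)) :
    lip g k (L ∘ₖ K) ≤ lip h k L * lip g h K := by
  refine lip_le fun m₁ h₁ m₂ h₂ => ?_
  rw [← Measure.comp_assoc, ← Measure.comp_assoc, mul_assoc]
  exact (weightedTV_bind_le_lip_mul hh h0 k L (hK h₁) (hK h₂)).trans
    (mul_le_mul_right (weightedTV_bind_le_lip_mul hg g0 h K h₁ h₂) _)

theorem lip_comp_le_ofReal_sq [IsFiniteKernel K] [IsFiniteKernel L] (hg : Measurable g)
    (g0 : ∀ z, 0 < g z) (hh : Measurable h) (h0 : ∀ z, 0 < h z)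
    (hK : Set.MapsTo (fun m : Measure Z => m.bind K) (probG g) (probG h)) (hr : 0 ≤ r)
    (hlipK : lip g h K ≤ ENNReal.ofReal r) (hlipL : lip h k L ≤ ENNReal.ofReal r) :
    lip g k (L ∘ₖ K) ≤ ENNReal.ofReal (r ^ 2) := by
  rw [sq, ENNReal.ofReal_mul hr]
  exact (lip_comp_le hg g0 hh h0 hK).trans (mul_le_mul' hlipL hlipK)

theorem exists_forall_abs_sub_le {ι : Type*} [Nonempty ι] {φ ψ : ι → ℝ}
    (H : ∀ i j, φ i - φ j ≤ ψ i + ψ j) : ∃ c, ∀ i, |φ i - c| ≤ ψ i := by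
  have hle (i j : ι) : φ i - ψ i ≤ φ j + ψ j := by linarith [H i j]
  have hbdd : BddAbove (Set.range fun i => φ i - ψ i) :=
    ⟨φ (Classical.arbitrary ι) + ψ (Classical.arbitrary ι), by rintro _ ⟨i, rfl⟩; exact hle i _⟩
  refine ⟨⨆ i, (φ i - ψ i), fun i => abs_sub_le_iff.2 ⟨?_, ?_⟩⟩
  · linarith [le_ciSup hbdd i]
  · linarith [ciSup_le fun j => hle j i]

theorem integrable_integral_kernel {m : Measure Z} {f : Z' → ℝ} [IsSFiniteKernel K]
    (hf : Measurable f) (hfi : Integrable f (m.bind K)) : Integrable (fun z => ∫ y, f y ∂K z) m :=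
  (Measure.integrable_integral_norm_of_integrable_comp hfi).mono'
    hf.stronglyMeasurable.integral_kernel.aestronglyMeasurable
    (.of_forall fun _ => norm_integral_le_integral_norm _)

theorem integral_bind_kernel {m : Measure Z} {f : Z' → ℝ} (hfi : Integrable f (m.bind K)) :
    ∫ y, f y ∂(m.bind K) = ∫ z, ∫ y, f y ∂K z ∂m := by
  rw [Measure.comp_eq_comp_const_apply] at hfi ⊢
  simpa using Kernel.integral_comp hfi

/-- If `f` realizes the dual norm of `m₁K - m₂K`, the hypothesis bounds the oscillation of `Kf`,
so that `Kf` minus a suitable constant is a test function for `|m₁ - m₂|(g)`. -/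
theorem lip_le_of_weightedTV_le [IsMarkovKernel K] (hg : Measurable g) (g0 : ∀ z, 0 ≤ g z)
    (hh : Measurable h) (h0 : ∀ z, 0 ≤ h z) (hr : 0 ≤ r)
    (hmaps : Set.MapsTo (fun m : Measure Z => m.bind K) (probG g) (probG h))
    (hK : ∀ x x', weightedTV h (K x) (K x') ≤ ENNReal.ofReal (r * (g x + g x'))) :
    lip g h K ≤ ENNReal.ofReal r := by
  refine lip_le fun m₁ h₁ m₂ h₂ => ?_
  have := h₁.1
  have := h₂.1
  have := m₁.nonempty_of_neZero
  have i₁ := integrable_of_mem_probG hg g0 h₁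
  have i₂ := integrable_of_mem_probG hg g0 h₂
  have hhK {m : Measure Z} (hm : m ∈ probG g) : Integrable h (m.bind K) :=
    integrable_of_mem_probG hh h0 (hmaps hm)
  have hhKx (x : Z) : Integrable h (K x) := by
    simpa only [Measure.dirac_bind K.measurable] using hhK (dirac_mem_probG hg x)
  obtain ⟨f, hf, hfh, hdual⟩ :=
    exists_integral_sub_integral_eq_toReal_weightedTV hh h0 (hhK h₁) (hhK h₂)
  have hfi {m : Measure Z'} (hm : Integrable h m) : Integrable f m :=
    hm.mono' hf.aestronglyMeasurable (.of_forall hfh)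
  let φ : Z → ℝ := fun x => ∫ y, f y ∂K x
  have hφi {m : Measure Z} (hm : m ∈ probG g) : Integrable φ m :=
    integrable_integral_kernel hf (hfi (hhK hm))
  have hosc (x x' : Z) : φ x - φ x' ≤ r * g x + r * g x' := by
    rw [← mul_add]
    exact (integral_sub_integral_le_toReal_weightedTV hf hfh (hhKx x) (hhKx x')).trans
      (ENNReal.toReal_le_of_le_ofReal (mul_nonneg hr (add_nonneg (g0 x) (g0 x'))) (hK x x'))
  obtain ⟨c, hc⟩ := exists_forall_abs_sub_le hosc
  have hφm : Measurable φ := (hf.stronglyMeasurable.integral_kernel (κ := K)).measurable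
  have key := integral_sub_integral_le_toReal_weightedTV (hφm.sub_const c) hc
    (i₁.const_mul r) (i₂.const_mul r)
  rw [integral_sub (hφi h₁) (integrable_const c), integral_sub (hφi h₂) (integrable_const c),
    weightedTV_const_mul hr] at key
  rw [← ENNReal.toReal_le_toReal (weightedTV_ne_top (hmaps h₁) (hmaps h₂))
    (ENNReal.mul_ne_top ENNReal.ofReal_ne_top (weightedTV_ne_top h₁ h₂)), ← hdual,
    integral_bind_kernel (hfi (hhK h₁)), integral_bind_kernel (hfi (hhK h₂))]
  simpa [φ] using key

theorem weightedTV_bind_le_of_bind_bind_eq {A C : Kernel Z Z'} {B : Kernel Z' Z}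
    [IsFiniteKernel B] [IsFiniteKernel C] {μ : Measure Z} {η : Measure Z'}
    (hh : Measurable h) (h0 : ∀ z, 0 < h z) (hμ : (μ.bind A).bind B = μ)
    (hη : (η.bind B).bind C = η) (hμA : μ.bind A ∈ probG h) (hηh : η ∈ probG h) :
    weightedTV h (μ.bind C) η ≤ lip h h (C ∘ₖ B) * weightedTV h (μ.bind A) η := by
  have key := weightedTV_bind_le_lip_mul hh h0 h (C ∘ₖ B) hμA hηh
  rwa [← Measure.comp_assoc, hμ, ← Measure.comp_assoc, hη] at key

end Lip

section Contraction

variable {Z Z' : Type*} [MeasurableSpace Z] [MeasurableSpace Z'] {K : Kernel Z Z'}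
  {f : Z → ℝ} {k : Z' → ℝ} {ε c R κ a r : ℝ}

/-- The geometric drift condition `K k ≤ ε f + c`, the Lyapunov function being `f` on the source
and `k` on the target of `K`. -/
def Drift (K : Kernel Z Z') (f : Z → ℝ) (k : Z' → ℝ) (ε c : ℝ) : Prop :=
  ∀ x, ∫⁻ y, ENNReal.ofReal (k y) ∂(K x) ≤ ENNReal.ofReal (ε * f x + c)

/-- The local minorization (small set) condition: on the sub-level set `{f ≤ R}` the measures
`K x` dominate a common measure of mass at least `κ`. -/
def Minorized (K : Kernel Z Z') (f : Z → ℝ) (R κ : ℝ) : Prop :=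
  ∃ m : Measure Z', ENNReal.ofReal κ ≤ m Set.univ ∧ ∀ x, f x ≤ R → m ≤ K x

/-- The inequalities on a weight parameter `a` and a rate `r` under which a Markov kernel with
drift constants `ε`, `c` that is minorized with mass `κ` below the level `R` contracts the total
variation weighted by `1/2 + a f` at the rate `r`. -/
structure IsContractionRate (ε c R κ a r : ℝ) : Prop where
  weight_pos : 0 < a
  rate_pos : 0 < r
  rate_lt_one : r < 1
  slope_le_rate : ε ≤ r
  weight_le : 4 * (a * c) ≤ κ
  one_sub_le_rate : 1 - κ / 2 ≤ r
  drift_le_rate : 1 + 2 * (a * c) + ε * (a * R) ≤ r * (1 + a * R)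

theorem Drift.mono {c' : ℝ} (h : Drift K f k ε c) (hc : c ≤ c') : Drift K f k ε c' :=
  fun x => (h x).trans (ENNReal.ofReal_le_ofReal (by gcongr))

theorem Minorized.mono {κ' : ℝ} (h : Minorized K f R κ) (hκ : κ' ≤ κ) : Minorized K f R κ' := by
  obtain ⟨m, hmass, hm⟩ := h
  exact ⟨m, (ENNReal.ofReal_le_ofReal hκ).trans hmass, hm⟩

theorem exists_isContractionRate (hε : 0 < ε) (hε1 : ε < 1) (hc : 0 ≤ c)
    (hR : 2 * c < (1 - ε) * R) (hκ : 0 < κ) : ∃ a r, IsContractionRate ε c R κ a r := by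
  have hR0 : 0 < R := pos_of_mul_pos_right (lt_of_le_of_lt (by positivity) hR) (by linarith)
  let a := κ / (4 * (c + 1))
  have ha : 0 < a := by positivity
  let q := (1 + 2 * (a * c) + ε * (a * R)) / (1 + a * R)
  have hden : 0 < 1 + a * R := by positivity
  have hq : q < 1 := by
    rw [div_lt_one hden]
    nlinarith [mul_lt_mul_of_pos_left hR ha]
  have hac : 4 * (a * c) ≤ κ :=
    calc 4 * (a * c) = κ * (c / (c + 1)) := by simp only [a]; field_simp
      _ ≤ κ := mul_le_of_le_one_right hκ.le (div_le_one_of_le₀ (by linarith) (by linarith))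
  refine ⟨a, max (1 - κ / 2) (max ε q), ha, ?_, ?_, ?_, hac, le_max_left _ _, ?_⟩
  · exact hε.trans_le ((le_max_left _ _).trans (le_max_right _ _))
  · exact max_lt (by linarith) (max_lt hε1 hq)
  · exact (le_max_left _ _).trans (le_max_right _ _)
  · rw [← div_le_iff₀ hden]
    exact (le_max_right _ _).trans (le_max_right _ _)

theorem Drift.lintegral_weight_le [IsMarkovKernel K] (hd : Drift K f k ε c) (k0 : ∀ y, 0 ≤ k y)
    (f0 : ∀ x, 0 ≤ f x) (hε : 0 ≤ ε) (hc : 0 ≤ c) (ha : 0 ≤ a) (x : Z) :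
    ∫⁻ y, ENNReal.ofReal (1 / 2 + a * k y) ∂(K x) ≤
      ENNReal.ofReal (1 / 2 + a * (ε * f x + c)) := by
  have := f0 x
  have half_add {t : ℝ} (ht : 0 ≤ t) : ENNReal.ofReal (1 / 2 + a * t) =
      ENNReal.ofReal (1 / 2) + ENNReal.ofReal a * ENNReal.ofReal t := by
    rw [ENNReal.ofReal_add (by norm_num) (by positivity), ENNReal.ofReal_mul ha]
  simp_rw [half_add (k0 _)]
  rw [half_add (by positivity), lintegral_add_left measurable_const,
    lintegral_const_mul' _ _ ENNReal.ofReal_ne_top, lintegral_const, measure_univ, mul_one]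
  gcongr
  exact hd x

theorem Drift.mapsTo_probG [IsMarkovKernel K] (hd : Drift K f k ε c) (hk : Measurable k)
    (k0 : ∀ y, 0 ≤ k y) (f0 : ∀ x, 0 ≤ f x) (hε : 0 ≤ ε) (hc : 0 ≤ c) (ha : 0 ≤ a) :
    Set.MapsTo (fun m : Measure Z => m.bind K) (probG fun x => 1 / 2 + a * f x)
      (probG fun y => 1 / 2 + a * k y) := by
  rintro m ⟨hm, hmf⟩
  refine ⟨inferInstance, ?_⟩
  rw [Measure.lintegral_bind K.aemeasurable (by fun_prop)]
  calc ∫⁻ x, ∫⁻ y, ENNReal.ofReal (1 / 2 + a * k y) ∂K x ∂m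
      ≤ ∫⁻ x, ENNReal.ofReal (ε + 2 * (a * c) + 1) * ENNReal.ofReal (1 / 2 + a * f x) ∂m := by
        refine lintegral_mono fun x => (hd.lintegral_weight_le k0 f0 hε hc ha x).trans ?_
        have haf := mul_nonneg ha (f0 x)
        have hac := mul_nonneg ha hc
        rw [← ENNReal.ofReal_mul (by positivity)]
        refine ENNReal.ofReal_le_ofReal ?_
        linarith [mul_nonneg hac haf]
    _ < ∞ := by
        rw [lintegral_const_mul' _ _ ENNReal.ofReal_ne_top]
        exact ENNReal.mul_lt_top ENNReal.ofReal_lt_top hmf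

theorem Drift.lintegral_weight_add_le [IsMarkovKernel K] (hd : Drift K f k ε c) (k0 : ∀ y, 0 ≤ k y)
    (f0 : ∀ x, 0 ≤ f x) (hε : 0 ≤ ε) (hc : 0 ≤ c) (ha : 0 ≤ a) (x x' : Z) :
    ∫⁻ y, ENNReal.ofReal (1 / 2 + a * k y) ∂(K x) +
        ∫⁻ y, ENNReal.ofReal (1 / 2 + a * k y) ∂(K x') ≤
      ENNReal.ofReal (1 + 2 * (a * c) + ε * (a * (f x + f x'))) := by
  have := f0 x
  have := f0 x'
  refine (add_le_add (hd.lintegral_weight_le k0 f0 hε hc ha x)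
    (hd.lintegral_weight_le k0 f0 hε hc ha x')).trans_eq ?_
  rw [← ENNReal.ofReal_add (by positivity) (by positivity)]
  ring_nf

/-- For `f x + f x' ≤ R` both measures share the minorizing measure, which saves `κ`; otherwise
the drift alone gains, since `ε f` is then small compared with `f`. -/
theorem Drift.weightedTV_le_of_minorized [IsMarkovKernel K] (hd : Drift K f k ε c)
    (hmin : Minorized K f R κ) (hrate : IsContractionRate ε c R κ a r) (k0 : ∀ y, 0 ≤ k y)
    (f0 : ∀ x, 0 ≤ f x) (hε : 0 ≤ ε) (hc : 0 ≤ c) (x x' : Z) :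
    weightedTV (fun y => 1 / 2 + a * k y) (K x) (K x') ≤
      ENNReal.ofReal (r * ((1 / 2 + a * f x) + (1 / 2 + a * f x'))) := by
  have ha := hrate.weight_pos.le
  have hsum := hd.lintegral_weight_add_le k0 f0 hε hc ha x x'
  have hgap : 0 ≤ (r - ε) * (a * (f x + f x')) :=
    mul_nonneg (sub_nonneg.2 hrate.slope_le_rate) (mul_nonneg ha (add_nonneg (f0 x) (f0 x')))
  rcases le_total (f x + f x') R with hlow | hhigh
  · obtain ⟨m, hmass, hm⟩ := hmin
    have hmκ : ENNReal.ofReal κ ≤ 2 * ∫⁻ y, ENNReal.ofReal (1 / 2 + a * k y) ∂m :=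
      calc ENNReal.ofReal κ ≤ 2 * ∫⁻ _, ENNReal.ofReal (1 / 2) ∂m := by
            rw [lintegral_const, ← mul_assoc, ← ENNReal.ofReal_ofNat 2,
              ← ENNReal.ofReal_mul zero_le_two]
            simpa using hmass
        _ ≤ _ := by
            gcongr with y
            exact le_add_of_nonneg_right (mul_nonneg ha (k0 y))
    have hoverlap := weightedTV_add_two_mul_lintegral_le (fun y => 1 / 2 + a * k y)
      (hm x (by linarith [f0 x'])) (hm x' (by linarith [f0 x]))
    have hbound : weightedTV (fun y => 1 / 2 + a * k y) (K x) (K x') + ENNReal.ofReal κ ≤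
        ENNReal.ofReal (1 + 2 * (a * c) + ε * (a * (f x + f x'))) := by
      refine le_trans ?_ (hoverlap.trans hsum)
      gcongr
    have hκ : 0 ≤ κ := le_trans (by positivity) hrate.weight_le
    refine (ENNReal.le_sub_of_add_le_right ENNReal.ofReal_ne_top hbound).trans ?_
    rw [← ENNReal.ofReal_sub _ hκ]
    refine ENNReal.ofReal_le_ofReal ?_
    linarith [hrate.weight_le, hrate.one_sub_le_rate]
  · refine (weightedTV_le _ _ _).trans (hsum.trans (ENNReal.ofReal_le_ofReal ?_))
    have hgain := mul_le_mul_of_nonneg_left (mul_le_mul_of_nonneg_left hhigh ha)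
      (sub_nonneg.2 hrate.slope_le_rate)
    linarith [hrate.drift_le_rate]

theorem Drift.lip_le_of_minorized [IsMarkovKernel K] (hd : Drift K f k ε c)
    (hmin : Minorized K f R κ) (hrate : IsContractionRate ε c R κ a r) (hf : Measurable f)
    (f0 : ∀ x, 0 ≤ f x) (hk : Measurable k) (k0 : ∀ y, 0 ≤ k y) (hε : 0 ≤ ε) (hc : 0 ≤ c) :
    lip (fun x => 1 / 2 + a * f x) (fun y => 1 / 2 + a * k y) K ≤ ENNReal.ofReal r := by
  have ha := hrate.weight_pos.le
  have weight_nonneg {t : ℝ} (ht : 0 ≤ t) : 0 ≤ 1 / 2 + a * t := by positivity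
  exact lip_le_of_weightedTV_le (by fun_prop) (fun x => weight_nonneg (f0 x)) (by fun_prop)
    (fun y => weight_nonneg (k0 y)) hrate.rate_pos.le (hd.mapsTo_probG hk k0 f0 hε hc ha)
    (hd.weightedTV_le_of_minorized hmin hrate k0 f0 hε hc)

end Contraction

/-- A scaling function `u = e^{-φ}` of a Schrödinger potential `φ`: integrable and uniformly
positive, so that `log u` is integrable as well. -/
structure IsPotential {X : Type*} [MeasurableSpace X] (μ : Measure X) (u : X → ℝ) : Prop where
  measurable : Measurable u
  integrable : Integrable u μ
  exists_le : ∃ c, 0 < c ∧ ∀ x, c ≤ u x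

namespace IsPotential

variable {X : Type*} [MeasurableSpace X] {μ : Measure X} {u w : X → ℝ}

theorem pos (hu : IsPotential μ u) (x : X) : 0 < u x :=
  let ⟨_, hc, hle⟩ := hu.exists_le
  hc.trans_le (hle x)

theorem integrable_div (hu : IsPotential μ u) (hw : IsPotential μ w) :
    Integrable (fun x => u x / w x) μ := by
  obtain ⟨c, hc, hle⟩ := hw.exists_le
  refine (hu.integrable.div_const c).mono'
    (hu.measurable.div hw.measurable).aestronglyMeasurable (.of_forall fun x => ?_)
  rw [Real.norm_of_nonneg (div_nonneg (hu.pos x).le (hw.pos x).le)]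
  exact div_le_div_of_nonneg_left (hu.pos x).le hc (hle x)

variable [IsProbabilityMeasure μ]

theorem one : IsPotential μ fun _ => 1 :=
  ⟨measurable_const, integrable_const 1, 1, one_pos, fun _ => le_rfl⟩

theorem integral_pos (hu : IsPotential μ u) : 0 < ∫ x, u x ∂μ := by
  obtain ⟨c, hc, hle⟩ := hu.exists_le
  calc 0 < ∫ _, c ∂μ := by simpa
    _ ≤ ∫ x, u x ∂μ := integral_mono (integrable_const c) hu.integrable hle

theorem integrable_log (hu : IsPotential μ u) : Integrable (fun x => Real.log (u x)) μ := by
  obtain ⟨c, hc, hle⟩ := hu.exists_le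
  exact integrable_of_le_of_le hu.measurable.log.aestronglyMeasurable
    (.of_forall fun x => Real.log_le_log hc (hle x))
    (.of_forall fun x => Real.log_le_self (hu.pos x).le) (integrable_const _) hu.integrable

/-- Gibbs' inequality, from `log t ≤ t - 1`. -/
theorem integral_log_le_of_integral_div_le_one (hu : IsPotential μ u) (hw : IsPotential μ w)
    (h : ∫ x, u x / w x ∂μ ≤ 1) : ∫ x, Real.log (u x) ∂μ ≤ ∫ x, Real.log (w x) ∂μ := by
  have hle : ∫ x, (Real.log (u x) - Real.log (w x)) ∂μ ≤ ∫ x, (u x / w x - 1) ∂μ := by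
    refine integral_mono (hu.integrable_log.sub hw.integrable_log)
      ((hu.integrable_div hw).sub (integrable_const 1)) fun x => ?_
    dsimp only
    rw [← Real.log_div (hu.pos x).ne' (hw.pos x).ne']
    exact Real.log_le_sub_one_of_pos (div_pos (hu.pos x) (hw.pos x))
  rw [integral_sub hu.integrable_log hw.integrable_log,
    integral_sub (hu.integrable_div hw) (integrable_const 1)] at hle
  simp only [integral_const, probReal_univ, one_smul] at hle
  linarith

end IsPotential

/-- The bounds on a cost `W` under which the Schrödinger map `schrodinger η W` maps potentials on
`Y` to potentials on `X`. Requiring them for the transposed cost too makes the Sinkhorn iteration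
well defined. -/
structure AdmissibleCost {X Y : Type*} [MeasurableSpace X] [MeasurableSpace Y]
    (μ : Measure X) (η : Measure Y) (W : X → Y → ℝ) (M : ℝ) : Prop where
  measurable : Measurable (Function.uncurry W)
  one_le : 1 ≤ M
  exp_neg_le : ∀ x y, Real.exp (-W x y) ≤ M
  integrable : ∀ x, Integrable (W x) η
  integrable_exp : Integrable (fun x => Real.exp (∫ y, W x y ∂η)) μ

/-- The Schrödinger map: `schrodinger η W v` is the scaling function `u` for which
`u(x) e^{-W(x,y)} v(y) η(dy)` is a probability measure for every `x`. -/
noncomputable def schrodinger {X Y : Type*} [MeasurableSpace Y] (η : Measure Y) (W : X → Y → ℝ)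
    (v : Y → ℝ) : X → ℝ :=
  fun x => (∫ y, Real.exp (-W x y) * v y ∂η)⁻¹

section Schrodinger

variable {X Y : Type*} [MeasurableSpace X] [MeasurableSpace Y] {μ : Measure X} {η : Measure Y}
  {W : X → Y → ℝ} {u : X → ℝ} {v : Y → ℝ} {M : ℝ}

theorem measurable_schrodinger [SFinite η] (hW : Measurable (Function.uncurry W))
    (hv : Measurable v) : Measurable (schrodinger η W v) := by
  have h : Measurable (Function.uncurry fun x y => Real.exp (-W x y) * v y) :=
    (hW.neg.exp).mul (hv.comp measurable_snd)
  exact (h.stronglyMeasurable.integral_prod_right).measurable.inv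

namespace AdmissibleCost

theorem pos (h : AdmissibleCost μ η W M) : 0 < M :=
  one_pos.trans_le h.one_le

theorem integrable_exp_neg_mul (h : AdmissibleCost μ η W M) (hv : Integrable v η) (x : X) :
    Integrable (fun y => Real.exp (-W x y) * v y) η := by
  have hWx : Measurable (W x) := h.measurable.of_uncurry_left
  refine hv.bdd_mul (c := M) hWx.neg.exp.aestronglyMeasurable (.of_forall fun y => ?_)
  rw [Real.norm_of_nonneg (Real.exp_nonneg _)]
  exact h.exp_neg_le x y

variable [IsProbabilityMeasure η]

/-- Jensen's inequality for the exponential function. -/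
theorem exp_le_integral_exp_neg_mul (h : AdmissibleCost μ η W M) (hv : IsPotential η v) (x : X) :
    Real.exp (∫ y, Real.log (v y) ∂η - ∫ y, W x y ∂η) ≤ ∫ y, Real.exp (-W x y) * v y ∂η := by
  have exp_eq (y : Y) : Real.exp (-W x y) * v y = Real.exp (Real.log (v y) - W x y) := by
    rw [sub_eq_neg_add, Real.exp_add, Real.exp_log (hv.pos y)]
  have hint := h.integrable_exp_neg_mul hv.integrable x
  simp_rw [exp_eq] at hint ⊢
  rw [← integral_sub hv.integrable_log (h.integrable x)]
  exact convexOn_exp.map_integral_le Real.continuous_exp.continuousOn isClosed_univ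
    (.of_forall fun _ => Set.mem_univ _) (hv.integrable_log.sub (h.integrable x)) hint

theorem integral_exp_neg_mul_pos (h : AdmissibleCost μ η W M) (hv : IsPotential η v) (x : X) :
    0 < ∫ y, Real.exp (-W x y) * v y ∂η :=
  (Real.exp_pos _).trans_le (h.exp_le_integral_exp_neg_mul hv x)

theorem schrodinger_pos (h : AdmissibleCost μ η W M) (hv : IsPotential η v) (x : X) :
    0 < schrodinger η W v x :=
  inv_pos.2 (h.integral_exp_neg_mul_pos hv x)

theorem schrodinger_le_exp (h : AdmissibleCost μ η W M) (hv : IsPotential η v) {l : ℝ}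
    (hl : l ≤ ∫ y, Real.log (v y) ∂η) (x : X) :
    schrodinger η W v x ≤ Real.exp (∫ y, W x y ∂η - l) := by
  rw [schrodinger, inv_le_comm₀ (h.integral_exp_neg_mul_pos hv x) (Real.exp_pos _),
    ← Real.exp_neg, neg_sub]
  exact (Real.exp_le_exp.2 (by gcongr)).trans (h.exp_le_integral_exp_neg_mul hv x)

theorem inv_le_schrodinger (h : AdmissibleCost μ η W M) (hv : IsPotential η v) {w : Y → ℝ}
    (hw : Integrable w η) (hvw : ∀ y, v y ≤ w y) (x : X) :
    (M * ∫ y, w y ∂η)⁻¹ ≤ schrodinger η W v x := by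
  refine inv_anti₀ (h.integral_exp_neg_mul_pos hv x) ?_
  rw [← integral_const_mul]
  refine integral_mono (h.integrable_exp_neg_mul hv.integrable x) (hw.const_mul M) fun y => ?_
  exact mul_le_mul (h.exp_neg_le x y) (hvw y) (hv.pos y).le h.pos.le

theorem isPotential_schrodinger (h : AdmissibleCost μ η W M) (hv : IsPotential η v) :
    IsPotential μ (schrodinger η W v) where
  measurable := measurable_schrodinger h.measurable hv.measurable
  integrable := by
    refine (h.integrable_exp.div_const (Real.exp (∫ y, Real.log (v y) ∂η))).mono'
      (measurable_schrodinger h.measurable hv.measurable).aestronglyMeasurable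
      (.of_forall fun x => ?_)
    rw [Real.norm_of_nonneg (h.schrodinger_pos hv x).le, ← Real.exp_sub]
    exact h.schrodinger_le_exp hv le_rfl x
  exists_le := ⟨_, inv_pos.2 (mul_pos h.pos hv.integral_pos),
    h.inv_le_schrodinger hv hv.integrable fun _ => le_rfl⟩

variable [IsProbabilityMeasure μ]

/-- Both sides are the total mass of the measure with density `u(x) e^{-W(x,y)} v(y)`, where
`v = schrodinger μ Wᵀ u` is chosen to make its second marginal equal to `η`. -/
theorem integral_div_schrodinger_schrodinger (h : AdmissibleCost η μ (fun y x => W x y) M)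
    (hu : IsPotential μ u) :
    ∫ x, u x / schrodinger η W (schrodinger μ (fun y x => W x y) u) x ∂μ = 1 := by
  let v := schrodinger μ (fun y x => W x y) u
  let f : X → Y → ℝ := fun x y => Real.exp (-W x y) * (u x * v y)
  have hf : Integrable (Function.uncurry f) (μ.prod η) := by
    refine (hu.integrable.mul_prod (h.isPotential_schrodinger hu).integrable).bdd_mul (c := M)
      (h.measurable.comp measurable_swap).neg.exp.aestronglyMeasurable (.of_forall fun z => ?_)
    rw [Real.norm_of_nonneg (Real.exp_nonneg _)]
    exact h.exp_neg_le z.2 z.1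
  have integral_right (x : X) : ∫ y, f x y ∂η = u x / schrodinger η W v x := by
    rw [schrodinger, div_inv_eq_mul, ← integral_const_mul]
    exact integral_congr_ae (.of_forall fun y => mul_left_comm _ _ _)
  have integral_left (y : Y) : ∫ x, f x y ∂μ = 1 := by
    calc ∫ x, f x y ∂μ = v y * ∫ x, Real.exp (-W x y) * u x ∂μ := by
          rw [← integral_const_mul]
          exact integral_congr_ae (.of_forall fun x => by simp only [f]; ring)
      _ = 1 := inv_mul_cancel₀ (h.integral_exp_neg_mul_pos hu y).ne'
  simpa [integral_right, integral_left] using integral_integral_swap hf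

theorem integral_log_le_integral_log_schrodinger (h : AdmissibleCost μ η W M)
    (h' : AdmissibleCost η μ (fun y x => W x y) M) (hu : IsPotential μ u) :
    ∫ x, Real.log (u x) ∂μ ≤
      ∫ x, Real.log (schrodinger η W (schrodinger μ (fun y x => W x y) u) x) ∂μ :=
  hu.integral_log_le_of_integral_div_le_one
    (h.isPotential_schrodinger (h'.isPotential_schrodinger hu))
    (h'.integral_div_schrodinger_schrodinger hu).le

end AdmissibleCost

end Schrodinger

/-- The scaling function `u_n` of the Sinkhorn kernel `K_{2n}`, whose density is proportional to
`u_n(x) e^{-W(x,y)} e^{-V(y)} v_{n-1}(y)` with `v` the sequence `sinkhornRight`. It equals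
`e^{U - U_{2n}}` in terms of the Sinkhorn potentials. -/
noncomputable def sinkhornLeft {X Y : Type*} [MeasurableSpace X] [MeasurableSpace Y]
    (μ : Measure X) (η : Measure Y) (W : X → Y → ℝ) : ℕ → X → ℝ
  | 0 => fun _ => 1
  | n + 1 => schrodinger η W (schrodinger μ (fun y x => W x y) (sinkhornLeft μ η W n))

/-- The scaling function `v_n` of the Sinkhorn kernel `K_{2n+1}`, whose density is
`v_n(y) e^{-W(x,y)} e^{-U(x)} u_n(x)` with `u` the sequence `sinkhornLeft`. -/
noncomputable def sinkhornRight {X Y : Type*} [MeasurableSpace X] [MeasurableSpace Y]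
    (μ : Measure X) (η : Measure Y) (W : X → Y → ℝ) (n : ℕ) : Y → ℝ :=
  schrodinger μ (fun y x => W x y) (sinkhornLeft μ η W n)

/-- Two-sided bounds `b ≤ u ≤ C e^w` on a measurable function. -/
structure Sandwiched {Z : Type*} [MeasurableSpace Z] (b C : ℝ) (w u : Z → ℝ) : Prop where
  measurable : Measurable u
  le : ∀ z, b ≤ u z
  le_exp : ∀ z, u z ≤ C * Real.exp (w z)

section SinkhornPotentials

variable {X Y : Type*} [MeasurableSpace X] [MeasurableSpace Y] {μ : Measure X} {η : Measure Y}
  {W : X → Y → ℝ} {M : ℝ} [IsProbabilityMeasure μ] [IsProbabilityMeasure η]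

namespace AdmissibleCost

theorem isPotential_sinkhornLeft (h : AdmissibleCost μ η W M)
    (h' : AdmissibleCost η μ (fun y x => W x y) M) (n : ℕ) :
    IsPotential μ (sinkhornLeft μ η W n) := by
  induction n with
  | zero => exact .one
  | succ n ih => exact h.isPotential_schrodinger (h'.isPotential_schrodinger ih)

theorem isPotential_sinkhornRight (h : AdmissibleCost μ η W M)
    (h' : AdmissibleCost η μ (fun y x => W x y) M) (n : ℕ) :
    IsPotential η (sinkhornRight μ η W n) :=
  h'.isPotential_schrodinger (h.isPotential_sinkhornLeft h' n)

theorem integral_log_sinkhornLeft_nonneg (h : AdmissibleCost μ η W M)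
    (h' : AdmissibleCost η μ (fun y x => W x y) M) (n : ℕ) :
    0 ≤ ∫ x, Real.log (sinkhornLeft μ η W n x) ∂μ := by
  induction n with
  | zero => simp [sinkhornLeft]
  | succ n ih =>
    exact ih.trans
      (h.integral_log_le_integral_log_schrodinger h' (h.isPotential_sinkhornLeft h' n))

theorem neg_log_le_integral_log_sinkhornRight (h : AdmissibleCost μ η W M)
    (h' : AdmissibleCost η μ (fun y x => W x y) M) (n : ℕ) :
    -Real.log M ≤ ∫ y, Real.log (sinkhornRight μ η W n y) ∂η := by
  induction n with
  | zero =>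
    have hle (y : Y) : -Real.log M ≤ Real.log (sinkhornRight μ η W 0 y) := by
      rw [← Real.log_inv]
      refine Real.log_le_log (inv_pos.2 h.pos) ?_
      simpa [sinkhornRight, sinkhornLeft] using
        h'.inv_le_schrodinger .one (integrable_const 1) (fun _ => le_rfl) y
    simpa using integral_mono (integrable_const _)
      (h.isPotential_sinkhornRight h' 0).integrable_log hle
  | succ n ih =>
    exact ih.trans
      (h'.integral_log_le_integral_log_schrodinger h (h.isPotential_sinkhornRight h' n))

theorem sinkhornRight_le (h : AdmissibleCost μ η W M)
    (h' : AdmissibleCost η μ (fun y x => W x y) M) (n : ℕ) (y : Y) :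
    sinkhornRight μ η W n y ≤ M * Real.exp (∫ x, W x y ∂μ) := by
  have hle := h'.schrodinger_le_exp (h.isPotential_sinkhornLeft h' n)
    (h.integral_log_sinkhornLeft_nonneg h' n) y
  rw [sub_zero] at hle
  exact hle.trans (le_mul_of_one_le_left (Real.exp_nonneg _) h.one_le)

theorem sinkhornLeft_le (h : AdmissibleCost μ η W M)
    (h' : AdmissibleCost η μ (fun y x => W x y) M) (n : ℕ) (x : X) :
    sinkhornLeft μ η W n x ≤ M * Real.exp (∫ y, W x y ∂η) := by
  cases n with
  | zero =>
    have hle : M⁻¹ ≤ Real.exp (∫ y, W x y ∂η) := by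
      simpa using (h.inv_le_schrodinger .one (integrable_const 1) (fun _ => le_rfl) x).trans
        (h.schrodinger_le_exp .one (by simp : (0 : ℝ) ≤ _) x)
    rwa [inv_le_iff_one_le_mul₀' h.pos] at hle
  | succ n =>
    have hle := h.schrodinger_le_exp (h.isPotential_sinkhornRight h' n)
      (h.neg_log_le_integral_log_sinkhornRight h' n) x
    rwa [sub_neg_eq_add, add_comm, Real.exp_add, Real.exp_log h.pos] at hle

theorem exists_sandwiched (h : AdmissibleCost μ η W M)
    (h' : AdmissibleCost η μ (fun y x => W x y) M) :
    ∃ b, 0 < b ∧ ∀ n, Sandwiched b M (fun x => ∫ y, W x y ∂η) (sinkhornLeft μ η W n) ∧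
      Sandwiched b M (fun y => ∫ x, W x y ∂μ) (sinkhornRight μ η W n) := by
  let bLeft := (M * ∫ y, M * Real.exp (∫ x, W x y ∂μ) ∂η)⁻¹
  let bRight := (M * ∫ x, M * Real.exp (∫ y, W x y ∂η) ∂μ)⁻¹
  have hbLeft : 0 < bLeft := by
    simp only [bLeft, integral_const_mul]
    exact inv_pos.2 (mul_pos h.pos (mul_pos h.pos (integral_exp_pos h'.integrable_exp)))
  have hbRight : 0 < bRight := by
    simp only [bRight, integral_const_mul]
    exact inv_pos.2 (mul_pos h.pos (mul_pos h.pos (integral_exp_pos h.integrable_exp)))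
  have le_left (n : ℕ) (x : X) : min 1 bLeft ≤ sinkhornLeft μ η W n x := by
    cases n with
    | zero => exact min_le_left _ _
    | succ n =>
      exact (min_le_right _ _).trans (h.inv_le_schrodinger (h.isPotential_sinkhornRight h' n)
        (h'.integrable_exp.const_mul M) (h.sinkhornRight_le h' n) x)
  have le_right (n : ℕ) : ∀ y, bRight ≤ sinkhornRight μ η W n y :=
    h'.inv_le_schrodinger (h.isPotential_sinkhornLeft h' n) (h.integrable_exp.const_mul M)
      (h.sinkhornLeft_le h' n)
  refine ⟨min (min 1 bLeft) bRight, by positivity, fun n => ⟨⟨?_, ?_, ?_⟩, ⟨?_, ?_, ?_⟩⟩⟩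
  · exact (h.isPotential_sinkhornLeft h' n).measurable
  · exact fun x => (min_le_left _ _).trans (le_left n x)
  · exact h.sinkhornLeft_le h' n
  · exact (h.isPotential_sinkhornRight h' n).measurable
  · exact fun y => (min_le_right _ _).trans (le_right n y)
  · exact h.sinkhornRight_le h' n

end AdmissibleCost

end SinkhornPotentials

section OneSpace

variable {Z : Type*} [TopologicalSpace Z] {F w θ : Z → ℝ} {δ : ℝ}

theorem LocallyBounded.exists_bound (hF : LocallyBounded F) {K : Set Z} (hK : IsCompact K) :
    ∃ C, ∀ z ∈ K, |F z| ≤ C := by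
  refine hK.induction_on ⟨0, by simp⟩ (fun s t hst ⟨C, hC⟩ => ⟨C, fun z hz => hC z (hst hz)⟩)
    (fun s t ⟨C, hC⟩ ⟨D, hD⟩ => ⟨max C D, fun z hz => ?_⟩) fun z _ => ?_
  · exact hz.elim (fun hz => (hC z hz).trans (le_max_left _ _))
      fun hz => (hD z hz).trans (le_max_right _ _)
  · obtain ⟨C, hC⟩ := hF z
    exact ⟨_, mem_nhdsWithin_of_mem_nhds hC, C, fun _ => id⟩

theorem CompactSublevels.measurable [T2Space Z] [MeasurableSpace Z] [BorelSpace Z]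
    (hFc : CompactSublevels F) : Measurable F :=
  measurable_of_Iic fun l => (hFc l).isClosed.measurableSet

/-- Off the compact set `{1/θ ≤ 1/ε}` one has `θ < ε`; on it both `θ` and `F` are bounded. -/
theorem IsBZero.exists_exp_le_add (hθ : IsBZero θ) (hF : LocallyBounded F) (hδ : 0 ≤ δ)
    (h : ∀ z, Real.exp (-(δ * F z - w z)) ≤ θ z) {ε : ℝ} (hε : 0 < ε) :
    ∃ c, 0 < c ∧ ∀ z, Real.exp (w z) ≤ c + ε * Real.exp (δ * F z) := by
  obtain ⟨m, hm, hmθ⟩ := hθ.uniformly_positive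
  obtain ⟨B, hB⟩ := hF.exists_bound (hθ.compact_sublevels (1 / ε))
  refine ⟨m⁻¹ * Real.exp (δ * B), by positivity, fun z => ?_⟩
  have exp_le : Real.exp (w z) ≤ θ z * Real.exp (δ * F z) := by
    calc Real.exp (w z) = Real.exp (-(δ * F z - w z)) * Real.exp (δ * F z) := by
          rw [← Real.exp_add, neg_sub, sub_add_cancel]
      _ ≤ θ z * Real.exp (δ * F z) := by gcongr; exact h z
  rcases le_or_gt (1 / θ z) (1 / ε) with hz | hz
  · have hθz : θ z ≤ m⁻¹ := by
      simpa using one_div_le_one_div_of_le hm (hmθ z)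
    calc Real.exp (w z) ≤ θ z * Real.exp (δ * F z) := exp_le
      _ ≤ m⁻¹ * Real.exp (δ * B) := by gcongr; exact (le_abs_self _).trans (hB z hz)
      _ ≤ _ := le_add_of_nonneg_right (by positivity)
  · have hθz : θ z ≤ ε := (lt_of_one_div_lt_one_div hε hz).le
    calc Real.exp (w z) ≤ θ z * Real.exp (δ * F z) := exp_le
      _ ≤ ε * Real.exp (δ * F z) := by gcongr
      _ ≤ _ := le_add_of_nonneg_left (by positivity)

end OneSpace

theorem LocallyBounded.uncurry_swap {X Y : Type*} [TopologicalSpace X] [TopologicalSpace Y]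
    {W : X → Y → ℝ} (h : LocallyBounded (Function.uncurry W)) :
    LocallyBounded (Function.uncurry fun y x => W x y) := by
  rintro ⟨y, x⟩
  obtain ⟨C, hC⟩ := h (x, y)
  exact ⟨C, (continuous_swap.tendsto (y, x)).eventually hC⟩

section Gibbs

variable {Z : Type*} [MeasurableSpace Z] {ρ : Measure Z} {F : Z → ℝ} {δ : ℝ}

theorem integrable_exp_two_mul_gibbs (hF : Measurable F)
    (hfin : gibbs ρ (fun z => (1 - 2 * δ) * F z) Set.univ < ∞) :
    Integrable (fun z => Real.exp (2 * δ * F z)) (gibbs ρ F) := by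
  rw [← lintegral_ofReal_ne_top_iff_integrable (by fun_prop)
    (.of_forall fun z => Real.exp_nonneg _), gibbs,
    lintegral_withDensity_eq_lintegral_mul _ (by fun_prop) (by fun_prop)]
  rw [gibbs, withDensity_apply _ MeasurableSet.univ, Measure.restrict_univ] at hfin
  refine ne_of_eq_of_ne (lintegral_congr fun z => ?_) hfin.ne
  rw [Pi.mul_apply, ← ENNReal.ofReal_mul (Real.exp_nonneg _), ← Real.exp_add]
  congr 2
  ring

theorem integrable_exp_gibbs [IsFiniteMeasure (gibbs ρ F)] (hF : Measurable F)
    (hfin : gibbs ρ (fun z => (1 - 2 * δ) * F z) Set.univ < ∞) :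
    Integrable (fun z => Real.exp (δ * F z)) (gibbs ρ F) := by
  refine ((integrable_const 1).add (integrable_exp_two_mul_gibbs hF hfin)).mono'
    (by fun_prop) (.of_forall fun z => ?_)
  have hsq : Real.exp (2 * δ * F z) = Real.exp (δ * F z) ^ 2 := by
    rw [← Real.exp_nat_mul]
    congr 1
    push_cast
    ring
  rw [Real.norm_of_nonneg (Real.exp_nonneg _), Pi.add_apply, hsq]
  nlinarith [sq_nonneg (Real.exp (δ * F z) - 1)]

end Gibbs

section ConditionA

variable {X Y : Type*} [TopologicalSpace X] [MeasurableSpace X] [TopologicalSpace Y]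
  [MeasurableSpace Y] {lam : Measure X} {nu : Measure Y} {U : X → ℝ} {V : Y → ℝ} {W : X → Y → ℝ}
  {δ M : ℝ}

namespace ConditionA

theorem swap (hA : ConditionA lam nu U V W δ) : ConditionA nu lam V U (fun y x => W x y) δ where
  delta_pos := hA.delta_pos
  delta_lt := hA.delta_lt
  finite_left := hA.finite_right
  finite_right := hA.finite_left
  integrable_left := hA.integrable_right
  integrable_right := hA.integrable_left
  exists_theta_left := hA.exists_theta_right
  exists_theta_right := hA.exists_theta_left

theorem exists_exp_integral_le_add (hA : ConditionA lam nu U V W δ) (hU : LocallyBounded U)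
    {ε : ℝ} (hε : 0 < ε) :
    ∃ c, 0 < c ∧ ∀ x, Real.exp (∫ y, W x y ∂(gibbs nu V)) ≤ c + ε * Real.exp (δ * U x) := by
  obtain ⟨θ, hθ, h⟩ := hA.exists_theta_left
  exact hθ.exists_exp_le_add hU hA.delta_pos.le h hε

variable [IsFiniteMeasure (gibbs lam U)] [SFinite (gibbs nu V)]

theorem integrable_exp_mul_exp_integral (hA : ConditionA lam nu U V W δ)
    (hU : LocallyBounded U) (hUm : Measurable U) (hW : Measurable (Function.uncurry W)) :
    Integrable (fun x => Real.exp (δ * U x) * Real.exp (∫ y, W x y ∂(gibbs nu V)))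
      (gibbs lam U) := by
  obtain ⟨c, -, hle⟩ := hA.exists_exp_integral_le_add hU one_pos
  have hWV : Measurable fun x => ∫ y, W x y ∂(gibbs nu V) :=
    (hW.stronglyMeasurable.integral_prod_right).measurable
  refine (((integrable_exp_gibbs hUm hA.finite_left).const_mul c).add
    (integrable_exp_two_mul_gibbs hUm hA.finite_left)).mono' (by fun_prop) (.of_forall fun x => ?_)
  have hsq : Real.exp (2 * δ * U x) = Real.exp (δ * U x) * Real.exp (δ * U x) := by
    rw [← Real.exp_add]
    ring_nf
  rw [Real.norm_of_nonneg (by positivity), Pi.add_apply, hsq]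
  nlinarith [mul_le_mul_of_nonneg_left (hle x) (Real.exp_nonneg (δ * U x))]

theorem admissibleCost (hA : ConditionA lam nu U V W δ) (hU : LocallyBounded U)
    (hUm : Measurable U) (hW : Measurable (Function.uncurry W)) (h1 : 1 ≤ M)
    (hM : ∀ x y, Real.exp (-W x y) ≤ M) : AdmissibleCost (gibbs lam U) (gibbs nu V) W M where
  measurable := hW
  one_le := h1
  exp_neg_le := hM
  integrable := hA.integrable_left
  integrable_exp := by
    obtain ⟨c, -, hle⟩ := hA.exists_exp_integral_le_add hU one_pos
    refine ((integrable_const c).add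
      ((integrable_exp_gibbs hUm hA.finite_left).const_mul 1)).mono'
      (hW.stronglyMeasurable.integral_prod_right).measurable.exp.aestronglyMeasurable
      (.of_forall fun x => ?_)
    rw [Real.norm_of_nonneg (Real.exp_nonneg _)]
    exact hle x

end ConditionA

end ConditionA

section Bayes

variable {A B : Type*} [MeasurableSpace A] {ρ : Measure A} {p : A → ℝ≥0∞} {q : A → B → ℝ≥0∞}

/-- The density of the observation `B` when `A` has the density `p` and `B` has the conditional
density `q a` given `A = a`: the normalizing constant of Bayes' rule. -/
noncomputable def evidence (ρ : Measure A) (p : A → ℝ≥0∞) (q : A → B → ℝ≥0∞) (b : B) : ℝ≥0∞ :=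
  ∫⁻ a, p a * q a b ∂ρ

theorem evidence_mul_bayes {b : B} (h0 : evidence ρ p q b ≠ 0) (htop : evidence ρ p q b ≠ ∞)
    (a : A) : evidence ρ p q b * bayes ρ p q b a = p a * q a b :=
  ENNReal.mul_div_cancel h0 htop

theorem lintegral_bayes {b : B} (h0 : evidence ρ p q b ≠ 0) (htop : evidence ρ p q b ≠ ∞) :
    ∫⁻ a, bayes ρ p q b a ∂ρ = 1 := by
  calc ∫⁻ a, bayes ρ p q b a ∂ρ = ∫⁻ a, p a * q a b * (evidence ρ p q b)⁻¹ ∂ρ := rfl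
    _ = evidence ρ p q b * (evidence ρ p q b)⁻¹ :=
      lintegral_mul_const' _ _ (ENNReal.inv_ne_top.2 h0)
    _ = 1 := ENNReal.mul_inv_cancel h0 htop

variable [MeasurableSpace B] {ν : Measure B}

theorem measurable_evidence [SFinite ρ] (hp : Measurable p)
    (hq : Measurable (Function.uncurry q)) : Measurable (evidence ρ p q) :=
  ((hp.comp measurable_fst).mul hq).lintegral_prod_left'

theorem measurable_bayes [SFinite ρ] (hp : Measurable p) (hq : Measurable (Function.uncurry q)) :
    Measurable (Function.uncurry (bayes ρ p q)) :=
  ((hp.comp measurable_snd).mul (hq.comp measurable_swap)).div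
    ((measurable_evidence hp hq).comp measurable_fst)

theorem isMarkovKernel_withDensity_const [SFinite ν] (hq : Measurable (Function.uncurry q))
    (hq1 : ∀ a, ∫⁻ b, q a b ∂ν = 1) :
    IsMarkovKernel (Kernel.withDensity (Kernel.const A ν) q) :=
  ⟨fun a => ⟨by simpa [Kernel.withDensity_apply' _ hq] using hq1 a⟩⟩

variable [SFinite ρ] [SFinite ν]

theorem bind_withDensity_of_detailed_balance {p' : B → ℝ≥0∞} {q' : B → A → ℝ≥0∞}
    (hp : Measurable p) (hq : Measurable (Function.uncurry q))
    (hq' : Measurable (Function.uncurry q')) (h : ∀ a b, p a * q a b = p' b * q' b a)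
    (hq'1 : ∀ b, ∫⁻ a, q' b a ∂ρ = 1) :
    (ρ.withDensity p).bind (Kernel.withDensity (Kernel.const A ν) q) = ν.withDensity p' := by
  ext s hs
  rw [Measure.bind_apply hs (Kernel.aemeasurable _), withDensity_apply _ hs,
    lintegral_withDensity_eq_lintegral_mul _ hp (Kernel.measurable_coe _ hs)]
  simp only [Pi.mul_apply, Kernel.withDensity_apply' _ hq, Kernel.const_apply]
  calc ∫⁻ a, p a * ∫⁻ b in s, q a b ∂ν ∂ρ = ∫⁻ a, ∫⁻ b in s, p a * q a b ∂ν ∂ρ :=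
        lintegral_congr fun a => (lintegral_const_mul _ hq.of_uncurry_left).symm
    _ = ∫⁻ b in s, ∫⁻ a, p a * q a b ∂ρ ∂ν :=
        lintegral_lintegral_swap ((hp.comp measurable_fst).mul hq).aemeasurable
    _ = ∫⁻ b in s, p' b ∂ν := lintegral_congr fun b => by
        simp_rw [h]
        rw [lintegral_const_mul _ hq'.of_uncurry_left, hq'1, mul_one]

theorem bind_bind_bayes (hp : Measurable p) (hq : Measurable (Function.uncurry q))
    (hq1 : ∀ a, ∫⁻ b, q a b ∂ν = 1) (h0 : ∀ b, evidence ρ p q b ≠ 0)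
    (htop : ∀ b, evidence ρ p q b ≠ ∞) :
    ((ρ.withDensity p).bind (Kernel.withDensity (Kernel.const A ν) q)).bind
      (Kernel.withDensity (Kernel.const B ρ) (bayes ρ p q)) = ρ.withDensity p := by
  have hbayes := measurable_bayes (ρ := ρ) hp hq
  have balance (a : A) (b : B) : p a * q a b = evidence ρ p q b * bayes ρ p q b a :=
    (evidence_mul_bayes (h0 b) (htop b) a).symm
  rw [bind_withDensity_of_detailed_balance hp hq hbayes balance
      fun b => lintegral_bayes (h0 b) (htop b),
    bind_withDensity_of_detailed_balance (measurable_evidence hp hq) hbayes hq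
      (fun b a => (balance a b).symm) hq1]

end Bayes

/-- The diagonal scaling `u(x) e^{-W(x,y)} v(y)` of the Gibbs kernel `e^{-W}`. All Sinkhorn
transitions have densities of this form. -/
noncomputable def scaling {X Y : Type*} (W : X → Y → ℝ) (u : X → ℝ) (v : Y → ℝ) :
    X → Y → ℝ≥0∞ :=
  fun x y => ENNReal.ofReal (u x * Real.exp (-W x y) * v y)

theorem kernel_withDensity_const_gibbs {X Y : Type*} [MeasurableSpace X] [MeasurableSpace Y]
    {ν : Measure Y} [SFinite ν] {V : Y → ℝ} [SFinite (gibbs ν V)] (hV : Measurable V)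
    {q : X → Y → ℝ≥0∞} (hq : Measurable (Function.uncurry q)) :
    Kernel.withDensity (Kernel.const X (gibbs ν V)) q = Kernel.withDensity (Kernel.const X ν)
      fun x y => ENNReal.ofReal (Real.exp (-V y)) * q x y := by
  have hexp : Measurable fun y => ENNReal.ofReal (Real.exp (-V y)) := by fun_prop
  ext1 x
  rw [Kernel.withDensity_apply _ hq,
    Kernel.withDensity_apply _ ((hexp.comp measurable_snd).mul hq)]
  exact (withDensity_mul ν hexp hq.of_uncurry_left).symm

theorem smul_restrict_le_withDensity {Y : Type*} [MeasurableSpace Y] {η : Measure Y} {S : Set Y}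
    (hS : MeasurableSet S) {κ : ℝ≥0∞} {q : Y → ℝ≥0∞} (h : ∀ y ∈ S, κ ≤ q y) :
    κ • η.restrict S ≤ η.withDensity q := by
  rw [← withDensity_const, ← withDensity_indicator hS]
  exact withDensity_mono (.of_forall fun y =>
    Set.indicator_apply_le' (h y) fun _ => zero_le)

theorem exists_measure_sublevel_ne_zero {Y : Type*} [MeasurableSpace Y] {η : Measure Y} [NeZero η]
    (V : Y → ℝ) : ∃ l : ℝ, η {y | V y ≤ l} ≠ 0 := by
  have hcover : ⋃ n : ℕ, {y | V y ≤ n} = Set.univ :=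
    Set.eq_univ_of_forall fun y => Set.mem_iUnion.2 (exists_nat_ge (V y))
  obtain ⟨n, hn⟩ := exists_measure_pos_of_not_measure_iUnion_null
    (μ := η) (s := fun n : ℕ => {y | V y ≤ n}) (by simp [hcover, NeZero.ne η])
  exact ⟨n, hn.ne'⟩

section Scaling

variable {X Y : Type*} [MeasurableSpace X] [MeasurableSpace Y] {η : Measure Y} [SFinite η]
  {W : X → Y → ℝ} {u : X → ℝ} {v : Y → ℝ} {M : ℝ}

theorem measurable_scaling (hW : Measurable (Function.uncurry W)) (hu : Measurable u)
    (hv : Measurable v) : Measurable (Function.uncurry (scaling W u v)) :=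
  (((hu.comp measurable_fst).mul hW.neg.exp).mul (hv.comp measurable_snd)).ennreal_ofReal

theorem lintegral_scaling_le (hW : Measurable (Function.uncurry W))
    (hM : ∀ x y, Real.exp (-W x y) ≤ M) (hu : Measurable u) (hv : Measurable v)
    (u0 : ∀ x, 0 ≤ u x) (v0 : ∀ y, 0 ≤ v y) {k s : Y → ℝ} (hk : Measurable k)
    (k0 : ∀ y, 0 ≤ k y) (hs : Integrable s η) (hvk : ∀ y, v y * k y ≤ s y) (x : X) :
    ∫⁻ y, ENNReal.ofReal (k y) ∂(Kernel.withDensity (Kernel.const X η) (scaling W u v) x) ≤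
      ENNReal.ofReal (u x * M * ∫ y, s y ∂η) := by
  have M0 (y : Y) : 0 ≤ M := (Real.exp_nonneg _).trans (hM x y)
  have s0 (y : Y) : 0 ≤ s y := (mul_nonneg (v0 y) (k0 y)).trans (hvk y)
  rw [Kernel.lintegral_withDensity _ (measurable_scaling hW hu hv) _ hk.ennreal_ofReal,
    Kernel.const_apply, ← integral_const_mul, ofReal_integral_eq_lintegral_ofReal
      (hs.const_mul _) (.of_forall fun y => mul_nonneg (mul_nonneg (u0 x) (M0 y)) (s0 y))]
  refine lintegral_mono fun y => ?_
  have := u0 x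
  have := v0 y
  rw [scaling, ← ENNReal.ofReal_mul (by positivity), mul_assoc]
  exact ENNReal.ofReal_le_ofReal (mul_le_mul (mul_le_mul_of_nonneg_left (hM x y) (u0 x)) (hvk y)
    (mul_nonneg (v0 y) (k0 y)) (mul_nonneg (u0 x) (M0 y)))

theorem minorized_scaling [IsFiniteMeasure η] (hW : Measurable (Function.uncurry W))
    (hu : Measurable u) (hv : Measurable v) {b B R : ℝ} (hb : 0 ≤ b) (hbu : ∀ x, b ≤ u x)
    (hbv : ∀ y, b ≤ v y) {f : X → ℝ} {S : Set Y} (hS : MeasurableSet S)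
    (hB : ∀ x, f x ≤ R → ∀ y ∈ S, W x y ≤ B) :
    Minorized (Kernel.withDensity (Kernel.const X η) (scaling W u v)) f R
      (b * Real.exp (-B) * b * η.real S) := by
  refine ⟨ENNReal.ofReal (b * Real.exp (-B) * b) • η.restrict S, ?_, fun x hx => ?_⟩
  · rw [ENNReal.ofReal_mul (by positivity)]
    simp
  · rw [Kernel.withDensity_apply _ (measurable_scaling hW hu hv), Kernel.const_apply]
    refine smul_restrict_le_withDensity hS fun y hy => ENNReal.ofReal_le_ofReal ?_
    have hux : 0 ≤ u x := hb.trans (hbu x)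
    gcongr
    exacts [hbu x, hB x hx y hy, hbv y]

theorem exists_minorized_scaling [TopologicalSpace X] [TopologicalSpace Y] [IsFiniteMeasure η]
    [NeZero η] {U : X → ℝ} {V : Y → ℝ} (hUc : CompactSublevels U) (hVc : CompactSublevels V)
    (hVm : Measurable V) (hWm : Measurable (Function.uncurry W))
    (hW : LocallyBounded (Function.uncurry W)) {δ b : ℝ} (hδ : 0 < δ) (hb : 0 < b) {R : ℝ}
    (hR : 0 < R) :
    ∃ κ, 0 < κ ∧ ∀ (u : X → ℝ) (v : Y → ℝ), Measurable u → Measurable v → (∀ x, b ≤ u x) →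
      (∀ y, b ≤ v y) → Minorized (Kernel.withDensity (Kernel.const X η) (scaling W u v))
        (fun x => Real.exp (δ * U x)) R κ := by
  obtain ⟨l, hl⟩ := exists_measure_sublevel_ne_zero (η := η) V
  obtain ⟨B, hB⟩ := hW.exists_bound ((hUc (Real.log R / δ)).prod (hVc l))
  have hpos : 0 < η.real {y | V y ≤ l} := ENNReal.toReal_pos hl (measure_ne_top _ _)
  refine ⟨b * Real.exp (-B) * b * η.real {y | V y ≤ l}, by positivity, fun u v hu hv hbu hbv =>
    minorized_scaling hWm hu hv hb.le hbu hbv (hVm measurableSet_Iic) fun x hx y hy => ?_⟩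
  have hxU : U x ≤ Real.log R / δ := by
    rwa [le_div_iff₀' hδ, Real.le_log_iff_exp_le hR]
  exact (le_abs_self _).trans (hB (x, y) ⟨hxU, hy⟩)

end Scaling

section UniformDrift

variable {X Y : Type*} [TopologicalSpace X] [MeasurableSpace X] [TopologicalSpace Y]
  [MeasurableSpace Y] {lam : Measure X} {nu : Measure Y} {U : X → ℝ} {V : Y → ℝ} {W : X → Y → ℝ}
  {δ M : ℝ}

theorem ConditionA.exists_drift_scaling [SFinite (gibbs lam U)] [IsFiniteMeasure (gibbs nu V)]
    (hA : ConditionA lam nu U V W δ) (hU : LocallyBounded U) (hV : LocallyBounded V)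
    (hVm : Measurable V) (hW : Measurable (Function.uncurry W)) (hM0 : 0 < M)
    (hM : ∀ x y, Real.exp (-W x y) ≤ M) {b ε : ℝ} (hb : 0 ≤ b) (hε : 0 < ε) :
    ∃ c, 0 ≤ c ∧ ∀ (u : X → ℝ) (v : Y → ℝ),
      Sandwiched b M (fun x => ∫ y, W x y ∂(gibbs nu V)) u →
      Sandwiched b M (fun y => ∫ x, W x y ∂(gibbs lam U)) v →
      Drift (Kernel.withDensity (Kernel.const X (gibbs nu V)) (scaling W u v))
        (fun x => Real.exp (δ * U x)) (fun y => Real.exp (δ * V y)) ε c := by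
  let s : Y → ℝ := fun y =>
    M * (Real.exp (δ * V y) * Real.exp (∫ x, W x y ∂(gibbs lam U)))
  have hs : Integrable s (gibbs nu V) :=
    (hA.swap.integrable_exp_mul_exp_integral hV hVm (hW.comp measurable_swap)).const_mul M
  let I := M * M * ∫ y, s y ∂(gibbs nu V)
  have : 0 ≤ I := mul_nonneg (by positivity) (integral_nonneg fun y => by positivity)
  obtain ⟨c, hc, hle⟩ := hA.exists_exp_integral_le_add hU (ε := ε / (I + 1)) (by positivity)
  refine ⟨I * c, by positivity, fun u v hu hv x => ?_⟩
  refine (lintegral_scaling_le hW hM hu.measurable hv.measurable (fun x => hb.trans (hu.le x))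
    (fun y => hb.trans (hv.le y)) (by fun_prop) (fun y => Real.exp_nonneg _) hs (fun y => ?_)
    x).trans (ENNReal.ofReal_le_ofReal ?_)
  · calc v y * Real.exp (δ * V y)
        ≤ M * Real.exp (∫ x, W x y ∂(gibbs lam U)) * Real.exp (δ * V y) := by
          gcongr; exact hv.le_exp y
      _ = s y := by simp only [s]; ring
  · have hslope : I * (ε / (I + 1)) ≤ ε := by
      rw [mul_div_left_comm]
      exact mul_le_of_le_one_right hε.le (div_le_one_of_le₀ (by linarith) (by positivity))
    calc u x * M * ∫ y, s y ∂(gibbs nu V)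
        ≤ M * (c + ε / (I + 1) * Real.exp (δ * U x)) * M * ∫ y, s y ∂(gibbs nu V) := by
          have : 0 ≤ ∫ y, s y ∂(gibbs nu V) := integral_nonneg fun y => by positivity
          gcongr
          exact (hu.le_exp x).trans (by gcongr; exact hle x)
      _ = I * (ε / (I + 1)) * Real.exp (δ * U x) + I * c := by simp only [I]; ring
      _ ≤ ε * Real.exp (δ * U x) + I * c := by gcongr

end UniformDrift

section BayesScaling

variable {X Y : Type*} [MeasurableSpace X] [MeasurableSpace Y] {lam : Measure X} {η : Measure Y}
  {U : X → ℝ} {W : X → Y → ℝ} {u : X → ℝ} {s : Y → ℝ} {M : ℝ}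

theorem evidence_scaling (hU : Measurable U)
    (h : AdmissibleCost η (gibbs lam U) (fun y x => W x y) M) (hu : IsPotential (gibbs lam U) u)
    {y : Y} (hs : 0 ≤ s y) :
    evidence lam (fun x => ENNReal.ofReal (Real.exp (-U x))) (scaling W u s) y =
      ENNReal.ofReal (s y / schrodinger (gibbs lam U) (fun y x => W x y) u y) := by
  have hWy : Measurable fun x => W x y := h.measurable.of_uncurry_left
  have hum := hu.measurable
  have scaling_eq (x : X) :
      scaling W u s x y = ENNReal.ofReal (s y * (Real.exp (-W x y) * u x)) := by
    rw [scaling]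
    ring_nf
  calc evidence lam (fun x => ENNReal.ofReal (Real.exp (-U x))) (scaling W u s) y
      = ∫⁻ x, ENNReal.ofReal (s y * (Real.exp (-W x y) * u x)) ∂(gibbs lam U) := by
        rw [gibbs, lintegral_withDensity_eq_lintegral_mul _ (by fun_prop) (by fun_prop)]
        simp only [evidence, scaling_eq, Pi.mul_apply]
    _ = ENNReal.ofReal (s y * ∫ x, Real.exp (-W x y) * u x ∂(gibbs lam U)) := by
        rw [← integral_const_mul, ofReal_integral_eq_lintegral_ofReal
          ((h.integrable_exp_neg_mul hu.integrable y).const_mul _) (.of_forall fun x =>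
            mul_nonneg hs (mul_nonneg (Real.exp_nonneg _) (hu.pos x).le))]
    _ = _ := by rw [schrodinger, div_inv_eq_mul]

variable [IsProbabilityMeasure (gibbs lam U)]

theorem evidence_scaling_ne_zero_and_ne_top (hU : Measurable U)
    (h : AdmissibleCost η (gibbs lam U) (fun y x => W x y) M) (hu : IsPotential (gibbs lam U) u)
    {y : Y} (hs : 0 < s y) :
    evidence lam (fun x => ENNReal.ofReal (Real.exp (-U x))) (scaling W u s) y ≠ 0 ∧
      evidence lam (fun x => ENNReal.ofReal (Real.exp (-U x))) (scaling W u s) y ≠ ∞ := by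
  rw [evidence_scaling hU h hu hs.le]
  exact ⟨(ENNReal.ofReal_pos.2 (div_pos hs (h.schrodinger_pos hu y))).ne', ENNReal.ofReal_ne_top⟩

theorem bayes_scaling (hU : Measurable U)
    (h : AdmissibleCost η (gibbs lam U) (fun y x => W x y) M) (hu : IsPotential (gibbs lam U) u)
    (hs : ∀ y, 0 < s y) :
    bayes lam (fun x => ENNReal.ofReal (Real.exp (-U x))) (scaling W u s) =
      scaling (fun y x => W x y) (schrodinger (gibbs lam U) (fun y x => W x y) u)
        fun x => Real.exp (-U x) * u x := by
  funext y x
  have hsy := hs y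
  have hv := h.schrodinger_pos hu y
  change _ / evidence lam _ (scaling W u s) y = _
  rw [evidence_scaling hU h hu hsy.le, scaling, scaling, ← ENNReal.ofReal_mul (Real.exp_nonneg _),
    ← ENNReal.ofReal_div_of_pos (div_pos hsy hv)]
  congr 1
  field_simp

end BayesScaling

theorem scaling_exp_neg_mul {X Y : Type*} {W : X → Y → ℝ} (V : Y → ℝ) (u : X → ℝ) (v : Y → ℝ) :
    scaling W u (fun y => Real.exp (-V y) * v y) =
      fun x y => ENNReal.ofReal (Real.exp (-V y)) * scaling W u v x y := by
  funext x y
  rw [scaling, scaling, ← ENNReal.ofReal_mul (Real.exp_nonneg _)]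
  ring_nf

theorem kernel_withDensity_scaling_exp_neg_mul {X Y : Type*} [MeasurableSpace X]
    [MeasurableSpace Y] {ν : Measure Y} [SFinite ν] {V : Y → ℝ} [SFinite (gibbs ν V)]
    {W : X → Y → ℝ} {u : X → ℝ} {v : Y → ℝ} (hV : Measurable V)
    (hW : Measurable (Function.uncurry W)) (hu : Measurable u) (hv : Measurable v) :
    Kernel.withDensity (Kernel.const X ν) (scaling W u fun y => Real.exp (-V y) * v y) =
      Kernel.withDensity (Kernel.const X (gibbs ν V)) (scaling W u v) := by
  rw [kernel_withDensity_const_gibbs hV (measurable_scaling hW hu hv), scaling_exp_neg_mul]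

section SinkhornDensities

variable {X Y : Type*} [MeasurableSpace X] [MeasurableSpace Y] {lam : Measure X} {nu : Measure Y}
  {U : X → ℝ} {V : Y → ℝ} {W : X → Y → ℝ} {M : ℝ}
  [IsProbabilityMeasure (gibbs lam U)] [IsProbabilityMeasure (gibbs nu V)]

theorem exists_evenDensity_eq_scaling (hU : Measurable U) (hV : Measurable V)
    (h : AdmissibleCost (gibbs lam U) (gibbs nu V) W M)
    (h' : AdmissibleCost (gibbs nu V) (gibbs lam U) (fun y x => W x y) M) (n : ℕ) :
    ∃ s : Y → ℝ, (∀ y, 0 < s y) ∧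
      evenDensity lam nu U V W n = scaling W (sinkhornLeft (gibbs lam U) (gibbs nu V) W n) s := by
  induction n with
  | zero =>
    refine ⟨fun _ => 1, fun _ => one_pos, ?_⟩
    funext x y
    simp [evenDensity, scaling, sinkhornLeft]
  | succ n ih =>
    obtain ⟨s, s0, hs⟩ := ih
    have hu := h.isPotential_sinkhornLeft h' n
    have hv := h.isPotential_sinkhornRight h' n
    refine ⟨fun y => Real.exp (-V y) * sinkhornRight (gibbs lam U) (gibbs nu V) W n y,
      fun y => mul_pos (Real.exp_pos _) (hv.pos y), ?_⟩
    rw [evenDensity, hs, bayes_scaling hU h' hu s0]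
    exact bayes_scaling hV h hv fun x => mul_pos (Real.exp_pos _) (hu.pos x)

theorem oddDensity_eq_scaling (hU : Measurable U) (hV : Measurable V)
    (h : AdmissibleCost (gibbs lam U) (gibbs nu V) W M)
    (h' : AdmissibleCost (gibbs nu V) (gibbs lam U) (fun y x => W x y) M) (n : ℕ) :
    oddDensity lam nu U V W n =
      scaling (fun y x => W x y) (sinkhornRight (gibbs lam U) (gibbs nu V) W n)
        fun x => Real.exp (-U x) * sinkhornLeft (gibbs lam U) (gibbs nu V) W n x := by
  obtain ⟨s, s0, hs⟩ := exists_evenDensity_eq_scaling hU hV h h' n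
  rw [oddDensity, hs]
  exact bayes_scaling hU h' (h.isPotential_sinkhornLeft h' n) s0

theorem evenDensity_succ_eq_scaling (hU : Measurable U) (hV : Measurable V)
    (h : AdmissibleCost (gibbs lam U) (gibbs nu V) W M)
    (h' : AdmissibleCost (gibbs nu V) (gibbs lam U) (fun y x => W x y) M) (n : ℕ) :
    evenDensity lam nu U V W (n + 1) = scaling W (sinkhornLeft (gibbs lam U) (gibbs nu V) W (n + 1))
      fun y => Real.exp (-V y) * sinkhornRight (gibbs lam U) (gibbs nu V) W n y := by
  change bayes nu _ (oddDensity lam nu U V W n) = _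
  rw [oddDensity_eq_scaling hU hV h h' n]
  exact bayes_scaling hV h (h.isPotential_sinkhornRight h' n)
    fun x => mul_pos (Real.exp_pos _) ((h.isPotential_sinkhornLeft h' n).pos x)

theorem evidence_evenDensity_ne_zero_and_ne_top (hU : Measurable U) (hV : Measurable V)
    (h : AdmissibleCost (gibbs lam U) (gibbs nu V) W M)
    (h' : AdmissibleCost (gibbs nu V) (gibbs lam U) (fun y x => W x y) M) (n : ℕ) (y : Y) :
    evidence lam (fun x => ENNReal.ofReal (Real.exp (-U x))) (evenDensity lam nu U V W n) y ≠ 0 ∧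
      evidence lam (fun x => ENNReal.ofReal (Real.exp (-U x))) (evenDensity lam nu U V W n) y ≠
        ∞ := by
  obtain ⟨s, s0, hs⟩ := exists_evenDensity_eq_scaling hU hV h h' n
  rw [hs]
  exact evidence_scaling_ne_zero_and_ne_top hU h' (h.isPotential_sinkhornLeft h' n) (s0 y)

theorem evidence_oddDensity_ne_zero_and_ne_top (hU : Measurable U) (hV : Measurable V)
    (h : AdmissibleCost (gibbs lam U) (gibbs nu V) W M)
    (h' : AdmissibleCost (gibbs nu V) (gibbs lam U) (fun y x => W x y) M) (n : ℕ) (x : X) :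
    evidence nu (fun y => ENNReal.ofReal (Real.exp (-V y))) (oddDensity lam nu U V W n) x ≠ 0 ∧
      evidence nu (fun y => ENNReal.ofReal (Real.exp (-V y))) (oddDensity lam nu U V W n) x ≠
        ∞ := by
  rw [oddDensity_eq_scaling hU hV h h' n]
  exact evidence_scaling_ne_zero_and_ne_top hV h (h.isPotential_sinkhornRight h' n)
    (mul_pos (Real.exp_pos _) ((h.isPotential_sinkhornLeft h' n).pos x))

theorem lintegral_oddDensity (hU : Measurable U) (hV : Measurable V)
    (h : AdmissibleCost (gibbs lam U) (gibbs nu V) W M)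
    (h' : AdmissibleCost (gibbs nu V) (gibbs lam U) (fun y x => W x y) M) (n : ℕ) (y : Y) :
    ∫⁻ x, oddDensity lam nu U V W n y x ∂lam = 1 :=
  have hev := evidence_evenDensity_ne_zero_and_ne_top hU hV h h' n y
  lintegral_bayes hev.1 hev.2

theorem lintegral_evenDensity (hU : Measurable U) (hV : Measurable V)
    (h : AdmissibleCost (gibbs lam U) (gibbs nu V) W M)
    (h' : AdmissibleCost (gibbs nu V) (gibbs lam U) (fun y x => W x y) M)
    (hK : ∀ x, ∫⁻ y, ENNReal.ofReal (Real.exp (-W x y)) ∂nu = 1) (n : ℕ) (x : X) :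
    ∫⁻ y, evenDensity lam nu U V W n x y ∂nu = 1 := by
  cases n with
  | zero => exact hK x
  | succ n =>
    have hev := evidence_oddDensity_ne_zero_and_ne_top hU hV h h' n x
    exact lintegral_bayes hev.1 hev.2

theorem evenK_succ_eq [SFinite nu] (hU : Measurable U) (hV : Measurable V)
    (h : AdmissibleCost (gibbs lam U) (gibbs nu V) W M)
    (h' : AdmissibleCost (gibbs nu V) (gibbs lam U) (fun y x => W x y) M) (n : ℕ) :
    evenK lam nu U V W (n + 1) = Kernel.withDensity (Kernel.const X (gibbs nu V))
      (scaling W (sinkhornLeft (gibbs lam U) (gibbs nu V) W (n + 1))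
        (sinkhornRight (gibbs lam U) (gibbs nu V) W n)) := by
  rw [evenK, evenDensity_succ_eq_scaling hU hV h h' n]
  exact kernel_withDensity_scaling_exp_neg_mul hV h.measurable
    (h.isPotential_sinkhornLeft h' _).measurable (h.isPotential_sinkhornRight h' _).measurable

theorem oddK_eq [SFinite lam] (hU : Measurable U) (hV : Measurable V)
    (h : AdmissibleCost (gibbs lam U) (gibbs nu V) W M)
    (h' : AdmissibleCost (gibbs nu V) (gibbs lam U) (fun y x => W x y) M) (n : ℕ) :
    oddK lam nu U V W n = Kernel.withDensity (Kernel.const Y (gibbs lam U))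
      (scaling (fun y x => W x y) (sinkhornRight (gibbs lam U) (gibbs nu V) W n)
        (sinkhornLeft (gibbs lam U) (gibbs nu V) W n)) := by
  rw [oddK, oddDensity_eq_scaling hU hV h h' n]
  exact kernel_withDensity_scaling_exp_neg_mul hU h'.measurable
    (h.isPotential_sinkhornRight h' _).measurable (h.isPotential_sinkhornLeft h' _).measurable

end SinkhornDensities

section SinkhornKernels

variable {X Y : Type*} [MeasurableSpace X] [MeasurableSpace Y] {lam : Measure X} {nu : Measure Y}
  [SFinite lam] [SFinite nu] {U : X → ℝ} {V : Y → ℝ} {W : X → Y → ℝ} {M : ℝ}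

theorem measurable_evenDensity (hU : Measurable U) (hV : Measurable V)
    (hW : Measurable (Function.uncurry W)) (n : ℕ) :
    Measurable (Function.uncurry (evenDensity lam nu U V W n)) := by
  induction n with
  | zero => exact hW.neg.exp.ennreal_ofReal
  | succ n ih => exact measurable_bayes (by fun_prop) (measurable_bayes (by fun_prop) ih)

theorem measurable_oddDensity (hU : Measurable U) (hV : Measurable V)
    (hW : Measurable (Function.uncurry W)) (n : ℕ) :
    Measurable (Function.uncurry (oddDensity lam nu U V W n)) :=
  measurable_bayes (by fun_prop) (measurable_evenDensity hU hV hW n)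

variable [IsProbabilityMeasure (gibbs lam U)] [IsProbabilityMeasure (gibbs nu V)]

theorem isMarkovKernel_evenK (hU : Measurable U) (hV : Measurable V)
    (h : AdmissibleCost (gibbs lam U) (gibbs nu V) W M)
    (h' : AdmissibleCost (gibbs nu V) (gibbs lam U) (fun y x => W x y) M)
    (hK : ∀ x, ∫⁻ y, ENNReal.ofReal (Real.exp (-W x y)) ∂nu = 1) (n : ℕ) :
    IsMarkovKernel (evenK lam nu U V W n) :=
  isMarkovKernel_withDensity_const (measurable_evenDensity hU hV h.measurable n)
    (lintegral_evenDensity hU hV h h' hK n)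

theorem isMarkovKernel_oddK (hU : Measurable U) (hV : Measurable V)
    (h : AdmissibleCost (gibbs lam U) (gibbs nu V) W M)
    (h' : AdmissibleCost (gibbs nu V) (gibbs lam U) (fun y x => W x y) M) (n : ℕ) :
    IsMarkovKernel (oddK lam nu U V W n) :=
  isMarkovKernel_withDensity_const (measurable_oddDensity hU hV h.measurable n)
    (lintegral_oddDensity hU hV h h' n)

theorem gibbs_bind_evenK_bind_oddK (hU : Measurable U) (hV : Measurable V)
    (h : AdmissibleCost (gibbs lam U) (gibbs nu V) W M)
    (h' : AdmissibleCost (gibbs nu V) (gibbs lam U) (fun y x => W x y) M)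
    (hK : ∀ x, ∫⁻ y, ENNReal.ofReal (Real.exp (-W x y)) ∂nu = 1) (n : ℕ) :
    ((gibbs lam U).bind (evenK lam nu U V W n)).bind (oddK lam nu U V W n) = gibbs lam U :=
  have hev := evidence_evenDensity_ne_zero_and_ne_top hU hV h h' n
  bind_bind_bayes (by fun_prop) (measurable_evenDensity hU hV h.measurable n)
    (lintegral_evenDensity hU hV h h' hK n) (fun y => (hev y).1) fun y => (hev y).2

theorem gibbs_bind_oddK_bind_evenK (hU : Measurable U) (hV : Measurable V)
    (h : AdmissibleCost (gibbs lam U) (gibbs nu V) W M)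
    (h' : AdmissibleCost (gibbs nu V) (gibbs lam U) (fun y x => W x y) M) (n : ℕ) :
    ((gibbs nu V).bind (oddK lam nu U V W n)).bind (evenK lam nu U V W (n + 1)) = gibbs nu V :=
  have hev := evidence_oddDensity_ne_zero_and_ne_top hU hV h h' n
  bind_bind_bayes (by fun_prop) (measurable_oddDensity hU hV h.measurable n)
    (lintegral_oddDensity hU hV h h' n) (fun x => (hev x).1) fun x => (hev x).2

end SinkhornKernels

section UniformEstimates

variable {X Y : Type*} [TopologicalSpace X] [MeasurableSpace X] [TopologicalSpace Y]
  [MeasurableSpace Y] {lam : Measure X} [SFinite lam] {nu : Measure Y} [SFinite nu]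
  {U : X → ℝ} {V : Y → ℝ} {W : X → Y → ℝ} {δ M : ℝ}
  [IsProbabilityMeasure (gibbs lam U)] [IsProbabilityMeasure (gibbs nu V)]

theorem exists_drift_sinkhorn (hA : ConditionA lam nu U V W δ) (hU : LocallyBounded U)
    (hUm : Measurable U) (hV : LocallyBounded V) (hVm : Measurable V)
    (h : AdmissibleCost (gibbs lam U) (gibbs nu V) W M)
    (h' : AdmissibleCost (gibbs nu V) (gibbs lam U) (fun y x => W x y) M) {ε : ℝ} (hε : 0 < ε) :
    ∃ c, 0 ≤ c ∧ ∀ n,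
      Drift (evenK lam nu U V W (n + 1)) (fun x => Real.exp (δ * U x))
        (fun y => Real.exp (δ * V y)) ε c ∧
      Drift (oddK lam nu U V W n) (fun y => Real.exp (δ * V y))
        (fun x => Real.exp (δ * U x)) ε c := by
  obtain ⟨b, hb, hsand⟩ := h.exists_sandwiched h'
  obtain ⟨c₁, hc₁, hd₁⟩ :=
    hA.exists_drift_scaling hU hV hVm h.measurable h.pos h.exp_neg_le hb.le hε
  obtain ⟨c₂, -, hd₂⟩ :=
    hA.swap.exists_drift_scaling hV hU hUm h'.measurable h'.pos h'.exp_neg_le hb.le hε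
  refine ⟨max c₁ c₂, le_max_of_le_left hc₁, fun n => ⟨?_, ?_⟩⟩
  · rw [evenK_succ_eq hUm hVm h h']
    exact (hd₁ _ _ (hsand _).1 (hsand n).2).mono (le_max_left _ _)
  · rw [oddK_eq hUm hVm h h']
    exact (hd₂ _ _ (hsand n).2 (hsand n).1).mono (le_max_right _ _)

theorem exists_minorized_sinkhorn (hUc : CompactSublevels U) (hUm : Measurable U)
    (hVc : CompactSublevels V) (hVm : Measurable V) (hW : LocallyBounded (Function.uncurry W))
    (h : AdmissibleCost (gibbs lam U) (gibbs nu V) W M)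
    (h' : AdmissibleCost (gibbs nu V) (gibbs lam U) (fun y x => W x y) M) (hδ : 0 < δ) {R : ℝ}
    (hR : 0 < R) :
    ∃ κ, 0 < κ ∧ ∀ n,
      Minorized (evenK lam nu U V W (n + 1)) (fun x => Real.exp (δ * U x)) R κ ∧
      Minorized (oddK lam nu U V W n) (fun y => Real.exp (δ * V y)) R κ := by
  obtain ⟨b, hb, hsand⟩ := h.exists_sandwiched h'
  obtain ⟨κ₁, hκ₁, hmin₁⟩ := exists_minorized_scaling (η := gibbs nu V) hUc hVc hVm h.measurable
    hW hδ hb hR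
  obtain ⟨κ₂, hκ₂, hmin₂⟩ := exists_minorized_scaling (η := gibbs lam U) hVc hUc hUm h'.measurable
    hW.uncurry_swap hδ hb hR
  refine ⟨min κ₁ κ₂, lt_min hκ₁ hκ₂, fun n => ⟨?_, ?_⟩⟩
  · have hu := (hsand (n + 1)).1
    have hv := (hsand n).2
    rw [evenK_succ_eq hUm hVm h h']
    exact (hmin₁ _ _ hu.measurable hv.measurable hu.le hv.le).mono (min_le_left _ _)
  · have hu := (hsand n).1
    have hv := (hsand n).2
    rw [oddK_eq hUm hVm h h']
    exact (hmin₂ _ _ hv.measurable hu.measurable hv.le hu.le).mono (min_le_right _ _)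

theorem exists_lipSinkhorn (hA : ConditionA lam nu U V W δ) (hU : LocallyBounded U)
    (hUc : CompactSublevels U) (hUm : Measurable U) (hV : LocallyBounded V)
    (hVc : CompactSublevels V) (hVm : Measurable V) (hW : LocallyBounded (Function.uncurry W))
    (h : AdmissibleCost (gibbs lam U) (gibbs nu V) W M)
    (h' : AdmissibleCost (gibbs nu V) (gibbs lam U) (fun y x => W x y) M)
    (hK : ∀ x, ∫⁻ y, ENNReal.ofReal (Real.exp (-W x y)) ∂nu = 1) :
    ∃ a r, 0 < a ∧ 0 < r ∧ r < 1 ∧ LipSinkhorn lam nu U V W δ a r := by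
  obtain ⟨c, hc, hdrift⟩ := exists_drift_sinkhorn hA hU hUm hV hVm h h' one_half_pos
  obtain ⟨κ, hκ, hmin⟩ := exists_minorized_sinkhorn hUc hUm hVc hVm hW h h' hA.delta_pos
    (by positivity : 0 < 4 * c + 1)
  obtain ⟨a, r, hrate⟩ :=
    exists_isContractionRate (R := 4 * c + 1) one_half_pos one_half_lt_one hc (by linarith) hκ
  have := isMarkovKernel_evenK hUm hVm h h' hK
  have := isMarkovKernel_oddK hUm hVm h h'
  refine ⟨a, r, hrate.weight_pos, hrate.rate_pos, hrate.rate_lt_one, fun n hn => ?_⟩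
  obtain ⟨m, rfl⟩ := Nat.exists_eq_add_of_le' hn
  exact sup_le
    ((hdrift m).1.lip_le_of_minorized (hmin m).1 hrate (by fun_prop) (fun _ => Real.exp_nonneg _)
      (by fun_prop) (fun _ => Real.exp_nonneg _) one_half_pos.le hc)
    ((hdrift (m + 1)).2.lip_le_of_minorized (hmin (m + 1)).2 hrate (by fun_prop)
      (fun _ => Real.exp_nonneg _) (by fun_prop) (fun _ => Real.exp_nonneg _) one_half_pos.le hc)

theorem mapsTo_probG_sinkhorn (hA : ConditionA lam nu U V W δ) (hU : LocallyBounded U)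
    (hUm : Measurable U) (hV : LocallyBounded V) (hVm : Measurable V)
    (h : AdmissibleCost (gibbs lam U) (gibbs nu V) W M)
    (h' : AdmissibleCost (gibbs nu V) (gibbs lam U) (fun y x => W x y) M)
    (hK : ∀ x, ∫⁻ y, ENNReal.ofReal (Real.exp (-W x y)) ∂nu = 1) {a : ℝ} (ha : 0 ≤ a) (n : ℕ) :
    Set.MapsTo (fun m : Measure X => m.bind (evenK lam nu U V W (n + 1)))
        (probG (weight a δ U)) (probG (weight a δ V)) ∧
      Set.MapsTo (fun m : Measure Y => m.bind (oddK lam nu U V W n))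
        (probG (weight a δ V)) (probG (weight a δ U)) := by
  obtain ⟨c, hc, hdrift⟩ := exists_drift_sinkhorn hA hU hUm hV hVm h h' one_half_pos
  have := isMarkovKernel_evenK hUm hVm h h' hK
  have := isMarkovKernel_oddK hUm hVm h h'
  exact ⟨(hdrift n).1.mapsTo_probG (by fun_prop) (fun _ => Real.exp_nonneg _)
      (fun _ => Real.exp_nonneg _) one_half_pos.le hc ha,
    (hdrift n).2.mapsTo_probG (by fun_prop) (fun _ => Real.exp_nonneg _)
      (fun _ => Real.exp_nonneg _) one_half_pos.le hc ha⟩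

end UniformEstimates

section Weight

variable {Z : Type*} {F : Z → ℝ} {a δ : ℝ}

theorem weight_pos (ha : 0 ≤ a) (δ : ℝ) (F : Z → ℝ) (z : Z) : 0 < weight a δ F z := by
  unfold weight
  positivity

variable [MeasurableSpace Z]

theorem measurable_weight (hF : Measurable F) (a δ : ℝ) : Measurable (weight a δ F) := by
  unfold weight
  fun_prop

theorem gibbs_mem_probG {ρ : Measure Z} [IsProbabilityMeasure (gibbs ρ F)] (hF : Measurable F)
    (hfin : gibbs ρ (fun z => (1 - 2 * δ) * F z) Set.univ < ∞) :
    gibbs ρ F ∈ probG (weight a δ F) :=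
  ⟨inferInstance,
    ((integrable_const _).add ((integrable_exp_gibbs hF hfin).const_mul a)).lintegral_lt_top⟩

end Weight

section Decay

variable {X Y : Type*} [MeasurableSpace X] [MeasurableSpace Y] {lam : Measure X} [SFinite lam]
  {nu : Measure Y} [SFinite nu] {U : X → ℝ} {V : Y → ℝ} {W : X → Y → ℝ} {δ a r : ℝ}
  [∀ n, IsMarkovKernel (evenK lam nu U V W n)] [∀ n, IsMarkovKernel (oddK lam nu U V W n)]

theorem LipSinkhorn.lip_oddS_le (hL : LipSinkhorn lam nu U V W δ a r) (hU : Measurable U)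
    (hV : Measurable V) (ha : 0 ≤ a) (hr : 0 ≤ r) {n : ℕ} (hn : 1 ≤ n)
    (hmaps : Set.MapsTo (fun m : Measure X => m.bind (evenK lam nu U V W n))
      (probG (weight a δ U)) (probG (weight a δ V))) :
    lip (weight a δ U) (weight a δ U) (oddS lam nu U V W n) ≤ ENNReal.ofReal (r ^ 2) :=
  lip_comp_le_ofReal_sq (measurable_weight hU a δ) (weight_pos ha δ U) (measurable_weight hV a δ)
    (weight_pos ha δ V) hmaps hr (le_sup_left.trans (hL n hn)) (le_sup_right.trans (hL n hn))

theorem LipSinkhorn.lip_evenS_le (hL : LipSinkhorn lam nu U V W δ a r) (hU : Measurable U)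
    (hV : Measurable V) (ha : 0 ≤ a) (hr : 0 ≤ r) {n : ℕ} (hn : 1 ≤ n)
    (hmaps : Set.MapsTo (fun m : Measure Y => m.bind (oddK lam nu U V W n))
      (probG (weight a δ V)) (probG (weight a δ U))) :
    lip (weight a δ V) (weight a δ V) (evenS lam nu U V W n) ≤ ENNReal.ofReal (r ^ 2) :=
  lip_comp_le_ofReal_sq (measurable_weight hV a δ) (weight_pos ha δ V) (measurable_weight hU a δ)
    (weight_pos ha δ U) hmaps hr (le_sup_right.trans (hL n hn))
    (le_sup_left.trans (hL (n + 1) n.succ_pos))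

theorem LipSinkhorn.weightedTV_evenMarginal_succ_le (hL : LipSinkhorn lam nu U V W δ a r)
    (hU : Measurable U) (hV : Measurable V) (ha : 0 ≤ a) (hr : 0 ≤ r) {n : ℕ} (hn : 1 ≤ n)
    (hmapsK : Set.MapsTo (fun m : Measure X => m.bind (evenK lam nu U V W n))
      (probG (weight a δ U)) (probG (weight a δ V)))
    (hmapsL : Set.MapsTo (fun m : Measure Y => m.bind (oddK lam nu U V W n))
      (probG (weight a δ V)) (probG (weight a δ U)))
    (hμ : gibbs lam U ∈ probG (weight a δ U)) (hη : gibbs nu V ∈ probG (weight a δ V))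
    (hμeq : ((gibbs lam U).bind (evenK lam nu U V W n)).bind (oddK lam nu U V W n) = gibbs lam U)
    (hηeq : ((gibbs nu V).bind (oddK lam nu U V W n)).bind (evenK lam nu U V W (n + 1)) =
      gibbs nu V) :
    weightedTV (weight a δ V) (evenMarginal lam nu U V W (n + 1)) (gibbs nu V) ≤
      ENNReal.ofReal (r ^ 2) *
        weightedTV (weight a δ V) (evenMarginal lam nu U V W n) (gibbs nu V) :=
  (weightedTV_bind_le_of_bind_bind_eq (measurable_weight hV a δ) (weight_pos ha δ V) hμeq hηeq
    (hmapsK hμ) hη).trans (mul_le_mul_left (hL.lip_evenS_le hU hV ha hr hn hmapsL) _)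

theorem LipSinkhorn.weightedTV_oddMarginal_succ_le (hL : LipSinkhorn lam nu U V W δ a r)
    (hU : Measurable U) (hV : Measurable V) (ha : 0 ≤ a) (hr : 0 ≤ r) {n : ℕ}
    (hmapsL : Set.MapsTo (fun m : Measure Y => m.bind (oddK lam nu U V W n))
      (probG (weight a δ V)) (probG (weight a δ U)))
    (hmapsK : Set.MapsTo (fun m : Measure X => m.bind (evenK lam nu U V W (n + 1)))
      (probG (weight a δ U)) (probG (weight a δ V)))
    (hμ : gibbs lam U ∈ probG (weight a δ U)) (hη : gibbs nu V ∈ probG (weight a δ V))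
    (hηeq : ((gibbs nu V).bind (oddK lam nu U V W n)).bind (evenK lam nu U V W (n + 1)) =
      gibbs nu V)
    (hμeq : ((gibbs lam U).bind (evenK lam nu U V W (n + 1))).bind
      (oddK lam nu U V W (n + 1)) = gibbs lam U) :
    weightedTV (weight a δ U) (oddMarginal lam nu U V W (n + 1)) (gibbs lam U) ≤
      ENNReal.ofReal (r ^ 2) *
        weightedTV (weight a δ U) (oddMarginal lam nu U V W n) (gibbs lam U) :=
  (weightedTV_bind_le_of_bind_bind_eq (measurable_weight hU a δ) (weight_pos ha δ U) hηeq hμeq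
    (hmapsL hη) hμ).trans (mul_le_mul_left (hL.lip_oddS_le hU hV ha hr n.succ_pos hmapsK) _)

end Decay

end Sinkhorn

theorem mainTheorem8_general {X Y : Type*}
    [TopologicalSpace X] [T2Space X] [MeasurableSpace X] [BorelSpace X]
    [TopologicalSpace Y] [T2Space Y] [MeasurableSpace Y] [BorelSpace Y]
    (lam : Measure X) [SFinite lam] (nu : Measure Y) [SFinite nu]
    (U : X → ℝ) (V : Y → ℝ) (W : X → Y → ℝ)
    (hU : Sinkhorn.LocallyBounded U) (hUc : Sinkhorn.CompactSublevels U)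
    (hV : Sinkhorn.LocallyBounded V) (hVc : Sinkhorn.CompactSublevels V)
    (hWm : Measurable (Function.uncurry W))
    (hW : Sinkhorn.LocallyBounded (Function.uncurry W))
    (hWb : ∃ C : ℝ, ∀ x y, Real.exp (-W x y) ≤ C)
    (hmu : IsProbabilityMeasure (Sinkhorn.gibbs lam U))
    (heta : IsProbabilityMeasure (Sinkhorn.gibbs nu V))
    (hK : ∀ x, ∫⁻ y, ENNReal.ofReal (Real.exp (-W x y)) ∂nu = 1)
    (δ : ℝ) (hA : Sinkhorn.ConditionA lam nu U V W δ) :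
    (∀ n : ℕ, IsMarkovKernel (Sinkhorn.evenK lam nu U V W n) ∧
      IsMarkovKernel (Sinkhorn.oddK lam nu U V W n)) ∧
    (∃ a r : ℝ, 0 < a ∧ 0 < r ∧ r < 1 ∧ Sinkhorn.LipSinkhorn lam nu U V W δ a r) ∧
    (∀ a r : ℝ, 0 ≤ a → 0 ≤ r → Sinkhorn.LipSinkhorn lam nu U V W δ a r →
      (⨆ (n : ℕ) (_ : 1 ≤ n),
        Sinkhorn.lip (Sinkhorn.weight a δ U) (Sinkhorn.weight a δ U)
            (Sinkhorn.oddS lam nu U V W n) ⊔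
          Sinkhorn.lip (Sinkhorn.weight a δ V) (Sinkhorn.weight a δ V)
            (Sinkhorn.evenS lam nu U V W n)) ≤ ENNReal.ofReal (r ^ 2) ∧
      ∀ n : ℕ, 1 ≤ n →
        Sinkhorn.weightedTV (Sinkhorn.weight a δ V)
            (Sinkhorn.evenMarginal lam nu U V W (n + 1)) (Sinkhorn.gibbs nu V) ≤
          ENNReal.ofReal (r ^ 2) * Sinkhorn.weightedTV (Sinkhorn.weight a δ V)
            (Sinkhorn.evenMarginal lam nu U V W n) (Sinkhorn.gibbs nu V) ∧
        Sinkhorn.weightedTV (Sinkhorn.weight a δ U)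
            (Sinkhorn.oddMarginal lam nu U V W n) (Sinkhorn.gibbs lam U) ≤
          ENNReal.ofReal (r ^ 2) * Sinkhorn.weightedTV (Sinkhorn.weight a δ U)
            (Sinkhorn.oddMarginal lam nu U V W (n - 1)) (Sinkhorn.gibbs lam U)) := by
  have hUm := hUc.measurable
  have hVm := hVc.measurable
  obtain ⟨C, hC⟩ := hWb
  have hM (x : X) (y : Y) : Real.exp (-W x y) ≤ max C 1 := (hC x y).trans (le_max_left _ _)
  have h := hA.admissibleCost hU hUm hWm (le_max_right C 1) hM
  have h' := hA.swap.admissibleCost hV hVm (hWm.comp measurable_swap) (le_max_right C 1)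
    fun y x => hM x y
  have hKm := Sinkhorn.isMarkovKernel_evenK hUm hVm h h' hK
  have hLm := Sinkhorn.isMarkovKernel_oddK hUm hVm h h'
  have hμeq := Sinkhorn.gibbs_bind_evenK_bind_oddK hUm hVm h h' hK
  have hηeq := Sinkhorn.gibbs_bind_oddK_bind_evenK hUm hVm h h'
  refine ⟨fun n => ⟨hKm n, hLm n⟩,
    Sinkhorn.exists_lipSinkhorn hA hU hUc hUm hV hVc hVm hW h h' hK, fun a r ha hr hL => ?_⟩
  have hmaps := Sinkhorn.mapsTo_probG_sinkhorn hA hU hUm hV hVm h h' hK ha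
  have hμ := Sinkhorn.gibbs_mem_probG (a := a) hUm hA.finite_left
  have hη := Sinkhorn.gibbs_mem_probG (a := a) hVm hA.finite_right
  refine ⟨iSup₂_le fun n hn => ?_, fun n hn => ?_⟩ <;>
    obtain ⟨m, rfl⟩ := Nat.exists_eq_add_of_le' hn
  · exact sup_le (hL.lip_oddS_le hUm hVm ha hr hn (hmaps m).1)
      (hL.lip_evenS_le hUm hVm ha hr hn (hmaps (m + 1)).2)
  · exact ⟨hL.weightedTV_evenMarginal_succ_le hUm hVm ha hr hn (hmaps m).1 (hmaps (m + 1)).2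
        hμ hη (hμeq _) (hηeq _),
      hL.weightedTV_oddMarginal_succ_le hUm hVm ha hr (hmaps m).2 (hmaps m).1 hμ hη (hηeq m)
        (hμeq (m + 1))⟩

theorem mainTheorem8
    {X Y : Type*}
    [TopologicalSpace X] [PolishSpace X] [LocallyCompactSpace X]
    [MeasurableSpace X] [BorelSpace X]
    [TopologicalSpace Y] [PolishSpace Y] [LocallyCompactSpace Y]
    [MeasurableSpace Y] [BorelSpace Y]
    (lam : Measure X) [IsLocallyFiniteMeasure lam]
    (nu : Measure Y) [IsLocallyFiniteMeasure nu]
    (U : X → ℝ) (V : Y → ℝ) (W : X → Y → ℝ)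
    (hU : Sinkhorn.LocallyBounded U) (hUc : Sinkhorn.CompactSublevels U)
    (hV : Sinkhorn.LocallyBounded V) (hVc : Sinkhorn.CompactSublevels V)
    (hWm : Measurable (Function.uncurry W))
    (hW : Sinkhorn.LocallyBounded (Function.uncurry W))
    (hWb : ∃ C : ℝ, ∀ x y, Real.exp (-W x y) ≤ C)
    (hmu : IsProbabilityMeasure (Sinkhorn.gibbs lam U))
    (heta : IsProbabilityMeasure (Sinkhorn.gibbs nu V))
    (hK : ∀ x, ∫⁻ y, ENNReal.ofReal (Real.exp (-W x y)) ∂nu = 1)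
    (δ : ℝ) (hA : Sinkhorn.ConditionA lam nu U V W δ) :
    (∀ n : ℕ, IsMarkovKernel (Sinkhorn.evenK lam nu U V W n) ∧
      IsMarkovKernel (Sinkhorn.oddK lam nu U V W n)) ∧
    (∃ a r : ℝ, 0 < a ∧ 0 < r ∧ r < 1 ∧ Sinkhorn.LipSinkhorn lam nu U V W δ a r) ∧
    (∀ a r : ℝ, 0 < a → 0 < r → r < 1 → Sinkhorn.LipSinkhorn lam nu U V W δ a r →
      (⨆ (n : ℕ) (_ : 1 ≤ n),
        Sinkhorn.lip (Sinkhorn.weight a δ U) (Sinkhorn.weight a δ U)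
            (Sinkhorn.oddS lam nu U V W n) ⊔
          Sinkhorn.lip (Sinkhorn.weight a δ V) (Sinkhorn.weight a δ V)
            (Sinkhorn.evenS lam nu U V W n)) ≤ ENNReal.ofReal (r ^ 2) ∧
      ∀ n : ℕ, 1 ≤ n →
        Sinkhorn.weightedTV (Sinkhorn.weight a δ V)
            (Sinkhorn.evenMarginal lam nu U V W (n + 1)) (Sinkhorn.gibbs nu V) ≤
          ENNReal.ofReal (r ^ 2) * Sinkhorn.weightedTV (Sinkhorn.weight a δ V)
            (Sinkhorn.evenMarginal lam nu U V W n) (Sinkhorn.gibbs nu V) ∧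
        Sinkhorn.weightedTV (Sinkhorn.weight a δ U)
            (Sinkhorn.oddMarginal lam nu U V W n) (Sinkhorn.gibbs lam U) ≤
          ENNReal.ofReal (r ^ 2) * Sinkhorn.weightedTV (Sinkhorn.weight a δ U)
            (Sinkhorn.oddMarginal lam nu U V W (n - 1)) (Sinkhorn.gibbs lam U)) := by
  obtain ⟨hMarkov, hlip, hdecay⟩ :=
    mainTheorem8_general lam nu U V W hU hUc hV hVc hWm hW hWb hmu heta hK δ hA
  exact ⟨hMarkov, hlip, fun a r ha hr _ => hdecay a r ha.le hr.le⟩
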